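/- Let $(X,d)$ be a compact metric space, $f:X\to X$ a homeomorphism, and $A:X\to GL(m,\mathbb{R})$ a continuous matrix function; put $A(x,n)=A(f^{n-1}x)\cdots A(fx)A(x)$ for $n\ge 1$. Let $\mathcal M(X)$ be the space of Borel probability measures on $X$ with the weak$^*$ topology, and let $\mathcal M_f(X)$ and $\mathcal M_f^e(X)$ be the sets of $f$-invariant and of ergodic $f$-invariant measures in $\mathcal M(X)$. For $\mu\in\mathcal M_f(X)$ the limit $\chi_{\max}(A,x)=\lim_{n\to\infty}\frac1n\log\|A(x,n)\|$ exists for $\mu$-a.e. $x$; the maximal Lyapunov exponent of $\mu$ is $\chi_{\max}(\mu)=\int\chi_{\max}(A,x)\,d\mu(x)$. Let $h_\mu(f)\in[0,\infty]$ be the metric (Kolmogorov–Sinai) entropy of $\mu$, and $h_{top}(f)\in[0,\infty]$ the topological entropy of $f$. Suppose that there are two ergodic measures with different maximal Lyapunov exponents. Then: (1) $$h_{top}(f)=\sup\{\max\{h_\mu(f),h_\nu(f)\} : \mu,\nu\in\mathcal M_f^e(X),\ \chi_{\max}(\mu)>\chi_{\max}(\nu)\}.$$ (2) Suppose that $f$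 is entropy-dense: for every $\nu\in\mathcal M_f(X)$, every neighborhood $G\subseteq\mathcal M(X)$ of $\nu$ and every real $h_*<h_\nu(f)$, there is $\mu\in G\cap\mathcal M_f^e(X)$ with $h_\mu(f)>h_*$. Then $$\sup\{h_\mu(f) : \mu\in\mathcal M_f^e(X),\ \chi_{\max}(\mu)>\inf_{\nu\in\mathcal M_f(X)}\chi_{\max}(\nu)\}=\sup\{\min\{h_\mu(f),h_\nu(f)\} : \mu,\nu\in\mathcal M_f^e(X),\ \chi_{\max}(\mu)>\chi_{\max}(\nu)\}.$$ If, further, $\mu\mapsto\chi_{\max}(\mu)$ is lower semicontinuous on $\mathcal M_f(X)$, then both of these suprema are equal to $h_{top}(f)$. -/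

import Mathlib

open MeasureTheory Filter Topology Dynamics
open scoped MatrixGroups

namespace LyapCocycle

section Cocycle

variable {X : Type*} {m : ℕ}

/-- The cocycle `A(x, n) = A(f^{n-1} x) ⋯ A(f x) A(x)` for `n ≥ 0` generated by `A` over `f`. -/
def cocycle (f : X → X) (A : X → GL (Fin m) ℝ) (x : X) : ℕ → GL (Fin m) ℝ
  | 0 => 1
  | n + 1 => A (f^[n] x) * cocycle f A x n

/-- The operator norm of a matrix with respect to the Euclidean norm on `ℝᵐ`. -/
noncomputable def opNorm (M : Matrix (Fin m) (Fin m) ℝ) : ℝ :=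
  ‖Matrix.toEuclideanCLM (n := Fin m) (𝕜 := ℝ) M‖

/-- The maximal Lyapunov exponent at a point, `lim (1/n) log ‖A(x, n)‖`. It is meaningful at points
where the limit exists, which is a set of full measure for every invariant probability measure. -/
noncomputable def mleAt (f : X → X) (A : X → GL (Fin m) ℝ) (x : X) : ℝ :=
  limUnder atTop fun n : ℕ =>
    (1 / (n : ℝ)) * Real.log (opNorm (cocycle f A x n : Matrix (Fin m) (Fin m) ℝ))

/-- The maximal Lyapunov exponent of a measure, `∫ χ_max(A, x) dμ(x)`. -/
noncomputable def mle [MeasurableSpace X] (f : X → X) (A : X → GL (Fin m) ℝ)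
    (μ : ProbabilityMeasure X) : ℝ :=
  ∫ x, mleAt f A x ∂(μ : Measure X)

end Cocycle

section Measures

variable {X : Type*} [MeasurableSpace X]

/-- The set of invariant probability measures. -/
def invariantMeasures (f : X → X) : Set (ProbabilityMeasure X) :=
  {μ | MeasurePreserving f (μ : Measure X) (μ : Measure X)}

/-- The set of ergodic invariant probability measures. -/
def ergodicMeasures (f : X → X) : Set (ProbabilityMeasure X) :=
  {μ | Ergodic f (μ : Measure X)}

/-- The itinerary of `x` up to time `n` with respect to the partition into the fibres of `P`; its
fibres are the elements of the joined partition `⋁_{i<n} f^{-i} P`. -/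
def itinerary {k : ℕ} (f : X → X) (P : X → Fin k) (n : ℕ) (x : X) : Fin n → Fin k :=
  fun i => P (f^[i] x)

/-- The Shannon entropy `H_μ(⋁_{i<n} f^{-i} P) = -∑ μ(C) log μ(C)`. -/
noncomputable def joinEntropy {k : ℕ} (f : X → X) (μ : ProbabilityMeasure X) (P : X → Fin k)
    (n : ℕ) : ℝ :=
  ∑ w : Fin n → Fin k, Real.negMulLog ((μ : Measure X).real (itinerary f P n ⁻¹' {w}))

/-- The entropy of `f` relative to a partition, `lim (1/n) H_μ(⋁_{i<n} f^{-i} P)`. For invariant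
`μ` the limit exists by subadditivity, so the upper limit is the limit. -/
noncomputable def partitionEntropy {k : ℕ} (f : X → X) (μ : ProbabilityMeasure X) (P : X → Fin k) :
    EReal :=
  limsup (fun n : ℕ => ((joinEntropy f μ P n / (n : ℝ) : ℝ) : EReal)) atTop

/-- The Kolmogorov–Sinai (metric) entropy `h_μ(f)`: the supremum over all finite measurable
partitions, a partition being given by a measurable map to a finite set. Possibly `+∞`. -/
noncomputable def metricEntropy (f : X → X) (μ : ProbabilityMeasure X) : EReal :=
  ⨆ (k : ℕ) (P : X → Fin k) (_ : Measurable P), partitionEntropy f μ P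

end Measures

/-- The topological entropy of `f` on the whole space (Bowen's definition). Possibly `+∞`. -/
noncomputable def topEntropy {X : Type*} [UniformSpace X] (f : X → X) : EReal :=
  coverEntropy f Set.univ

/-- The entropy-dense property: every invariant probability measure is approximated, in the weak*
topology and in entropy from below, by ergodic measures. -/
def EntropyDense {X : Type*} [TopologicalSpace X] [MeasurableSpace X] [OpensMeasurableSpace X]
    (f : X → X) : Prop :=
  ∀ ν ∈ invariantMeasures f, ∀ G ∈ 𝓝 ν, ∀ h : ℝ, (h : EReal) < metricEntropy f ν →
    ∃ μ ∈ ergodicMeasures f, μ ∈ G ∧ (h : EReal) < metricEntropy f μ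

/-- The supremum of `h_μ(f)` over the ergodic `μ` that are not Lyapunov-minimizing, that is,
`χ_max(μ, A) > inf_ν χ_max(ν, A)` with `ν` ranging over the invariant probability measures. -/
noncomputable def supNonMinimizing {X : Type*} [MeasurableSpace X] {m : ℕ} (f : X → X)
    (A : X → GL (Fin m) ℝ) : EReal :=
  ⨆ (μ ∈ ergodicMeasures f)
    (_ : (⨅ ν ∈ invariantMeasures f, (mle f A ν : EReal)) < (mle f A μ : EReal)),
    metricEntropy f μ

end LyapCocycle

/-! The engine is the variational principle in its ergodic form: entropies of ergodic measures never
exceed the topological entropy and come arbitrarily close to it (`metricEntropy_le_topEntropy`,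
`exists_ergodic_metricEntropy_gt`). For (1), an ergodic measure of nearly maximal entropy is paired
with one of the two given measures. At least one of them has a different exponent, and the maximum
ignores the entropy of the partner.

For (2) the partner must carry entropy too. If ν has a smaller exponent than μ, the mixture tμ + (1
- t)ν with t < 1 close to 1 still has a smaller exponent, since the exponent is affine (`mle_mix`),
and it loses little entropy, since its entropy is at least t times that of μ
(`exists_forall_lt_metricEntropy_mix`). The mixture need not be ergodic. But on invariant measures
the exponent is an infimum of weak* continuous functionals (`mle_eq_iInf`), hence upper
semicontinuous, so entropy density replaces the mixture by an ergodic measure without destroying the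
strict inequality. Under lower semicontinuity, a measure of almost maximal entropy is mixed with two
measures of distinct exponents, and both mixtures are approximated while a number between their
exponents keeps the approximations apart.

The exponent is controlled by Kingman's theorem, proved by cutting orbits into blocks on which the
liminf is almost attained. The upper half of the variational principle compares a partition with
disjoint compact sets and a remainder of small entropy; the lower half takes limits of orbit
averages of uniform measures on separated sets. An ergodic measure is then found among the
components of the limit measure: a finite invariant partition changes block entropies by a bounded
amount only, which is negligible per unit time, so the entropy rate of the limit measure is at most
the mean rate of its components. -/

namespace LyapCocycle

/-! ### Shannon entropy of finite-valued maps. -/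

section Shannon

variable {X α β ι : Type*} [MeasurableSpace X] [Fintype α] [Fintype β]

/-- The Shannon entropy of a map to a finite type with respect to a measure. -/
noncomputable def shannon (μ : Measure X) (g : X → α) : ℝ :=
  ∑ a, Real.negMulLog (μ.real (g ⁻¹' {a}))

lemma joinEntropy_eq_shannon {k : ℕ} (f : X → X) (μ : ProbabilityMeasure X) (P : X → Fin k)
    (n : ℕ) : joinEntropy f μ P n = shannon (μ : Measure X) (itinerary f P n) := rfl

/-- Every term is at most the sum and the logarithm is monotone. This is why merging cells lowers
entropy. -/
lemma negMulLog_sum_le {s : Finset ι} {p : ι → ℝ} (hp : ∀ i ∈ s, 0 ≤ p i) :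
    Real.negMulLog (∑ i ∈ s, p i) ≤ ∑ i ∈ s, Real.negMulLog (p i) := by
  simp only [Real.negMulLog]
  rw [← Finset.sum_neg_distrib, Finset.sum_mul]
  refine Finset.sum_le_sum fun i hi => ?_
  rcases (hp i hi).eq_or_lt with h | h
  · simp [← h]
  · have := Real.log_le_log h (Finset.single_le_sum hp hi)
    nlinarith

lemma cond_real_apply (μ : Measure X) {s : Set X} (hs : MeasurableSet s) (t : Set X) :
    (ProbabilityTheory.cond μ s).real t = (μ.real s)⁻¹ * μ.real (s ∩ t) := by
  simp [Measure.real, ProbabilityTheory.cond_apply hs, ENNReal.toReal_inv]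

lemma shannon_nonneg (μ : Measure X) [IsProbabilityMeasure μ] (g : X → α) : 0 ≤ shannon μ g :=
  Finset.sum_nonneg fun _ _ => Real.negMulLog_nonneg measureReal_nonneg measureReal_le_one

/-- Concavity of the Shannon entropy in the measure. -/
lemma sum_mul_shannon_le (s : Finset ι) (c : ι → ℝ) (hc : ∀ i ∈ s, 0 ≤ c i)
    (hc1 : ∑ i ∈ s, c i = 1) (μ : ι → Measure X) (ν : Measure X) (g : X → α)
    (h : ∀ a, ν.real (g ⁻¹' {a}) = ∑ i ∈ s, c i * (μ i).real (g ⁻¹' {a})) :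
    ∑ i ∈ s, c i * shannon (μ i) g ≤ shannon ν g := by
  simp only [shannon, Finset.mul_sum]
  rw [Finset.sum_comm]
  refine Finset.sum_le_sum fun a _ => ?_
  rw [h a]
  simpa using Real.concaveOn_negMulLog.le_map_sum (t := s) (w := c)
    (p := fun i => (μ i).real (g ⁻¹' {a})) hc hc1 (fun _ _ => measureReal_nonneg)

variable [MeasurableSpace α] [MeasurableSingletonClass α]

lemma sum_measureReal_fiber (μ : Measure X) [IsFiniteMeasure μ] {g : X → α} (hg : Measurable g)
    (s : Set X) (hs : MeasurableSet s) : ∑ a, μ.real (s ∩ g ⁻¹' {a}) = μ.real s := by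
  rw [← measureReal_biUnion_finset]
  · congr 1; ext x; simp
  · intro a _ b _ hab
    refine Set.disjoint_left.2 fun x hx hy => hab ?_
    rw [← hx.2, ← hy.2]
  · exact fun a _ => hs.inter (hg (measurableSet_singleton a))

lemma sum_measureReal_fiber_univ (μ : Measure X) [IsProbabilityMeasure μ] {g : X → α}
    (hg : Measurable g) : ∑ a, μ.real (g ⁻¹' {a}) = 1 := by
  simpa using sum_measureReal_fiber μ hg Set.univ MeasurableSet.univ

lemma shannon_le_log_card (μ : Measure X) [IsProbabilityMeasure μ] {g : X → α}
    (hg : Measurable g) : shannon μ g ≤ Real.log (Fintype.card α) := by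
  have hs := sum_measureReal_fiber_univ μ hg
  have hpos : 0 < (Fintype.card α : ℝ) := by
    rcases isEmpty_or_nonempty α with h | h
    · simp at hs
    · exact_mod_cast Fintype.card_pos
  have := Real.concaveOn_negMulLog.le_map_sum (t := Finset.univ)
    (w := fun _ : α => (Fintype.card α : ℝ)⁻¹) (p := fun a => μ.real (g ⁻¹' {a}))
    (fun _ _ => by positivity) (by simp [hpos.ne']) (fun _ _ => measureReal_nonneg)
  simp only [smul_eq_mul, ← Finset.mul_sum, hs, mul_one] at this
  have h2 : Real.negMulLog (Fintype.card α : ℝ)⁻¹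
      = (Fintype.card α : ℝ)⁻¹ * Real.log (Fintype.card α) := by
    simp [Real.negMulLog, Real.log_inv]
  rw [h2] at this
  exact le_of_mul_le_mul_left this (by positivity)

lemma shannon_map {Y : Type*} [MeasurableSpace Y] (μ : Measure Y) {f : Y → X} (hf : Measurable f)
    {g : X → α} (hg : Measurable g) : shannon (μ.map f) g = shannon μ (g ∘ f) := by
  refine Finset.sum_congr rfl fun a _ => ?_
  rw [map_measureReal_apply hf (hg (measurableSet_singleton a)), Set.preimage_comp]

lemma shannon_comp_le (μ : Measure X) [IsFiniteMeasure μ] {g : X → α} (hg : Measurable g)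
    (φ : α → β) : shannon μ (fun x => φ (g x)) ≤ shannon μ g := by
  classical
  have key : ∀ b, μ.real ((fun x => φ (g x)) ⁻¹' {b})
      = ∑ a with φ a = b, μ.real (g ⁻¹' {a}) := by
    intro b
    rw [← measureReal_biUnion_finset]
    · congr 1; ext x; simp
    · intro a _ b _ hab
      refine Set.disjoint_left.2 fun x hx hy => hab ?_
      rw [← hx, ← hy]
    · exact fun a _ => (hg (measurableSet_singleton a))
  calc shannon μ (fun x => φ (g x))
      = ∑ b, Real.negMulLog (∑ a with φ a = b, μ.real (g ⁻¹' {a})) := by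
        simp only [shannon, key]
    _ ≤ ∑ b, ∑ a with φ a = b, Real.negMulLog (μ.real (g ⁻¹' {a})) :=
        Finset.sum_le_sum fun b _ => negMulLog_sum_le fun _ _ => measureReal_nonneg
    _ = shannon μ g := Finset.sum_fiberwise _ _ _

variable [MeasurableSpace β] [MeasurableSingletonClass β]

/-- The chain rule for the Shannon entropy. -/
lemma shannon_prod (μ : Measure X) [IsProbabilityMeasure μ] {g : X → α} (hg : Measurable g)
    {h : X → β} (hh : Measurable h) :
    shannon μ (fun x => (g x, h x)) = shannon μ g +
      ∑ a, μ.real (g ⁻¹' {a}) * shannon (ProbabilityTheory.cond μ (g ⁻¹' {a})) h := by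
  simp only [shannon, Fintype.sum_prod_type, Finset.mul_sum]
  rw [← Finset.sum_add_distrib]
  refine Finset.sum_congr rfl fun a _ => ?_
  have hma := hg (measurableSet_singleton a)
  have hset : ∀ b, (fun x => (g x, h x)) ⁻¹' {(a, b)} = g ⁻¹' {a} ∩ h ⁻¹' {b} := by
    intro b; ext x; simp
  simp only [hset, cond_real_apply μ hma]
  by_cases h0 : μ.real (g ⁻¹' {a}) = 0
  · have : ∀ b, μ.real (g ⁻¹' {a} ∩ h ⁻¹' {b}) = 0 := fun b =>
      le_antisymm (h0 ▸ measureReal_mono Set.inter_subset_left) measureReal_nonneg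
    simp [this, h0]
  · have e : ∀ b, Real.negMulLog (μ.real (g ⁻¹' {a} ∩ h ⁻¹' {b})) =
        ((μ.real (g ⁻¹' {a}))⁻¹ * μ.real (g ⁻¹' {a} ∩ h ⁻¹' {b})) *
          Real.negMulLog (μ.real (g ⁻¹' {a})) + μ.real (g ⁻¹' {a}) *
          Real.negMulLog ((μ.real (g ⁻¹' {a}))⁻¹ * μ.real (g ⁻¹' {a} ∩ h ⁻¹' {b})) := by
      intro b
      rw [← Real.negMulLog_mul, mul_inv_cancel_left₀ h0]
    simp only [e]
    rw [Finset.sum_add_distrib, ← Finset.sum_mul, ← Finset.mul_sum,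
      sum_measureReal_fiber μ hh _ hma, inv_mul_cancel₀ h0, one_mul]

lemma measureReal_eq_sum_cond (μ : Measure X) [IsProbabilityMeasure μ] {g : X → α}
    (hg : Measurable g) (s : Set X) (hs : MeasurableSet s) :
    μ.real s = ∑ a, μ.real (g ⁻¹' {a}) * (ProbabilityTheory.cond μ (g ⁻¹' {a})).real s := by
  rw [← sum_measureReal_fiber μ hg s hs]
  refine Finset.sum_congr rfl fun a _ => ?_
  rw [cond_real_apply μ (hg (measurableSet_singleton a)), Set.inter_comm]
  by_cases h0 : μ.real (g ⁻¹' {a}) = 0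
  · rw [h0, zero_mul]
    exact le_antisymm (h0 ▸ measureReal_mono Set.inter_subset_left) measureReal_nonneg
  · rw [mul_inv_cancel_left₀ h0]

/-- By the chain rule it remains to bound the mean conditional entropy of h. The conditional
measures average to μ, so concavity of the entropy in the measure applies. -/
lemma shannon_prod_le (μ : Measure X) [IsProbabilityMeasure μ] {g : X → α} (hg : Measurable g)
    {h : X → β} (hh : Measurable h) :
    shannon μ (fun x => (g x, h x)) ≤ shannon μ g + shannon μ h := by
  rw [shannon_prod μ hg hh]
  gcongr
  exact sum_mul_shannon_le _ _ (fun _ _ => measureReal_nonneg) (sum_measureReal_fiber_univ μ hg)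
    _ _ _ fun b => measureReal_eq_sum_cond μ hg _ (hh (measurableSet_singleton b))

/-- The entropy of a mixture exceeds the mixture of the entropies by at most the logarithm of the
number of components. -/
lemma shannon_le_log_card_add (μ : Measure X) [IsProbabilityMeasure μ] {g : X → α}
    (hg : Measurable g) {h : X → β} (hh : Measurable h) :
    shannon μ h ≤ Real.log (Fintype.card α) +
      ∑ a, μ.real (g ⁻¹' {a}) * shannon (ProbabilityTheory.cond μ (g ⁻¹' {a})) h := by
  have h1 := shannon_comp_le μ (hg.prodMk hh) Prod.snd
  rw [shannon_prod μ hg hh] at h1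
  have h2 := shannon_le_log_card μ hg
  linarith

end Shannon

/-! ### Block entropies of itineraries. -/

section Itinerary

variable {X : Type*} [MeasurableSpace X] {k : ℕ} {f : X → X} {P : X → Fin k}

lemma measurable_itinerary (hf : Measurable f) (hP : Measurable P) (n : ℕ) :
    Measurable (itinerary f P n) :=
  measurable_pi_lambda _ fun i => hP.comp (hf.iterate i)

lemma shannon_itinerary_mono (μ : Measure X) [IsFiniteMeasure μ] (hf : Measurable f)
    (hP : Measurable P) {m n : ℕ} (h : m ≤ n) :
    shannon μ (itinerary f P m) ≤ shannon μ (itinerary f P n) :=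
  shannon_comp_le μ (measurable_itinerary hf hP n) fun w i => w (Fin.castLE h i)

lemma shannon_itinerary_add_le (μ : Measure X) [IsProbabilityMeasure μ] (hf : Measurable f)
    (hP : Measurable P) (m n : ℕ) :
    shannon μ (itinerary f P (m + n)) ≤
      shannon μ (itinerary f P m) + shannon μ (itinerary f P n ∘ f^[m]) := by
  have hm := measurable_itinerary hf hP m
  have hn := (measurable_itinerary hf hP n).comp (hf.iterate m)
  refine le_trans (le_of_eq ?_) ((shannon_comp_le μ (hm.prodMk hn)
    (fun p => (Fin.append p.1 p.2 : Fin (m + n) → Fin k))).trans (shannon_prod_le μ hm hn))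
  congr 1
  ext x i
  refine Fin.addCases (fun i => ?_) (fun i => ?_) i
  · simp [itinerary]
  · simp [itinerary, Function.iterate_add_apply, add_comm m]

lemma shannon_itinerary_le (μ : Measure X) [IsProbabilityMeasure μ] (hf : Measurable f)
    (hP : Measurable P) (n : ℕ) : shannon μ (itinerary f P n) ≤ n * Real.log k := by
  have := shannon_le_log_card μ (measurable_itinerary hf hP n)
  simpa using this

end Itinerary

/-! ### Kingman's subadditive ergodic theorem. -/

section Kingman

variable {X : Type*} [MeasurableSpace X]

/-- A measurable sequence of functions of at most linear growth that is subadditive over `f`. -/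
structure IsSubadditiveCocycle (f : X → X) (φ : ℕ → X → ℝ) (C : ℝ) : Prop where
  measurable : ∀ n, Measurable (φ n)
  bound : ∀ n x, |φ n x| ≤ C * n
  subadd : ∀ m n x, φ (m + n) x ≤ φ m x + φ n (f^[m] x)

variable {f : X → X} {φ : ℕ → X → ℝ} {C : ℝ}

namespace IsSubadditiveCocycle

lemma abs_div_le (h : IsSubadditiveCocycle f φ C) (hC : 0 ≤ C) (n : ℕ) (x : X) :
    |φ n x / n| ≤ C := by
  rcases Nat.eq_zero_or_pos n with rfl | hn
  · simpa using hC
  · have : (0 : ℝ) < n := by exact_mod_cast hn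
    rw [abs_div, abs_of_pos this, div_le_iff₀ this]
    exact h.bound n x

lemma isBounded_le (h : IsSubadditiveCocycle f φ C) (hC : 0 ≤ C) (x : X) :
    IsBoundedUnder (· ≤ ·) atTop fun n : ℕ => φ n x / n :=
  isBoundedUnder_of ⟨C, fun n => (abs_le.1 (h.abs_div_le hC n x)).2⟩

lemma isBounded_ge (h : IsSubadditiveCocycle f φ C) (hC : 0 ≤ C) (x : X) :
    IsBoundedUnder (· ≥ ·) atTop fun n : ℕ => φ n x / n :=
  isBoundedUnder_of ⟨-C, fun n => (abs_le.1 (h.abs_div_le hC n x)).1⟩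

lemma abs_liminf_le (h : IsSubadditiveCocycle f φ C) (hC : 0 ≤ C) (x : X) :
    |liminf (fun n : ℕ => φ n x / n) atTop| ≤ C := by
  rw [abs_le]
  constructor
  · exact le_liminf_of_le (h.isBounded_le hC x).isCoboundedUnder_ge
      (Eventually.of_forall fun n => (abs_le.1 (h.abs_div_le hC n x)).1)
  · exact liminf_le_of_le (h.isBounded_ge hC x) fun b hb => by
      obtain ⟨n, hn⟩ := hb.exists
      exact hn.trans (abs_le.1 (h.abs_div_le hC n x)).2

lemma abs_limsup_le (h : IsSubadditiveCocycle f φ C) (hC : 0 ≤ C) (x : X) :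
    |limsup (fun n : ℕ => φ n x / n) atTop| ≤ C := by
  rw [abs_le]
  constructor
  · exact le_limsup_of_le (h.isBounded_le hC x) fun b hb => by
      obtain ⟨n, hn⟩ := hb.exists
      exact (abs_le.1 (h.abs_div_le hC n x)).1.trans hn
  · exact limsup_le_of_le (h.isBounded_ge hC x).isCoboundedUnder_le
      (Eventually.of_forall fun n => (abs_le.1 (h.abs_div_le hC n x)).2)

lemma measurable_liminf (h : IsSubadditiveCocycle f φ C) :
    Measurable fun x => liminf (fun n : ℕ => φ n x / n) atTop :=
  .liminf fun n => (h.measurable n).div_const _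

lemma measurable_limsup (h : IsSubadditiveCocycle f φ C) :
    Measurable fun x => limsup (fun n : ℕ => φ n x / n) atTop :=
  .limsup fun n => (h.measurable n).div_const _

lemma integrable_liminf (h : IsSubadditiveCocycle f φ C) (hC : 0 ≤ C) (μ : Measure X)
    [IsFiniteMeasure μ] : Integrable (fun x => liminf (fun n : ℕ => φ n x / n) atTop) μ :=
  .of_bound h.measurable_liminf.aestronglyMeasurable C (ae_of_all _ (h.abs_liminf_le hC))

lemma integrable_limsup (h : IsSubadditiveCocycle f φ C) (hC : 0 ≤ C) (μ : Measure X)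
    [IsFiniteMeasure μ] : Integrable (fun x => limsup (fun n : ℕ => φ n x / n) atTop) μ :=
  .of_bound h.measurable_limsup.aestronglyMeasurable C (ae_of_all _ (h.abs_limsup_le hC))

lemma integrable (h : IsSubadditiveCocycle f φ C) (μ : Measure X)
    [IsFiniteMeasure μ] (n : ℕ) : Integrable (φ n) μ :=
  .of_bound (h.measurable n).aestronglyMeasurable (C * n) (ae_of_all _ (h.bound n))

lemma exists_le_of_liminf (h : IsSubadditiveCocycle f φ C) (hC : 0 ≤ C) {ε : ℝ} (hε : 0 < ε)
    (x : X) : ∃ n : ℕ, 0 < n ∧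
      φ n x ≤ n * (liminf (fun n : ℕ => φ n x / n) atTop + ε) := by
  have := frequently_lt_of_liminf_lt (h.isBounded_le hC x).isCoboundedUnder_ge
    (show liminf (fun n : ℕ => φ n x / n) atTop <
      liminf (fun n : ℕ => φ n x / n) atTop + ε by linarith)
  obtain ⟨n, hn, hn0⟩ := (this.and_eventually (eventually_gt_atTop 0)).exists
  refine ⟨n, hn0, ?_⟩
  have h0 : (0 : ℝ) < n := by exact_mod_cast hn0
  rw [div_lt_iff₀ h0] at hn
  linarith

/-- Subadditivity with first block of length 1 gives this direction at every point. Monotonicity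
along orbits is all the covering argument needs, so invariance of the liminf is never proved. -/
lemma liminf_le_liminf_apply (h : IsSubadditiveCocycle f φ C) (hC : 0 ≤ C) (x : X) :
    liminf (fun n : ℕ => φ n x / n) atTop ≤ liminf (fun n : ℕ => φ n (f x) / n) atTop := by
  refine le_of_forall_pos_lt_add fun ε hε => ?_
  by_contra hcon
  push Not at hcon
  have hev := eventually_lt_of_lt_liminf (b := liminf (fun n : ℕ => φ n x / n) atTop - ε / 4)
    (f := atTop) (u := fun n : ℕ => φ n x / n) (by linarith) (h.isBounded_ge hC x)
  have hfr := frequently_lt_of_liminf_lt (h.isBounded_le hC (f x)).isCoboundedUnder_ge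
    (show liminf (fun n : ℕ => φ n (f x) / n) atTop <
      liminf (fun n : ℕ => φ n (f x) / n) atTop + ε / 4 by linarith)
  set l := liminf (fun n : ℕ => φ n x / n) atTop with hl
  set l' := liminf (fun n : ℕ => φ n (f x) / n) atTop
  have hl1 : |l| ≤ C := h.abs_liminf_le hC x
  -- Assuming l' + ε ≤ l, the two estimates leave nε/2 < C - l + ε/4; this size of n contradicts |l|
  -- ≤ C.
  have hlarge : ∀ᶠ n : ℕ in atTop, 4 * (2 * C + ε) / ε < n :=
    tendsto_natCast_atTop_atTop.eventually_gt_atTop _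
  have hev' := (tendsto_add_atTop_nat 1).eventually hev
  obtain ⟨n, hn, ⟨hn1, hn2⟩, hn0⟩ :=
    (hfr.and_eventually ((hev'.and hlarge).and (eventually_gt_atTop 0))).exists
  have h0 : (0 : ℝ) < n := by exact_mod_cast hn0
  rw [div_lt_iff₀ h0] at hn
  rw [div_lt_iff₀ hε] at hn2
  push_cast at hn1
  rw [lt_div_iff₀ (by positivity)] at hn1
  have hs := h.subadd 1 n x
  rw [add_comm 1 n] at hs
  have hb := (abs_le.1 (h.bound 1 x)).2
  simp only [Function.iterate_one, Nat.cast_one, mul_one] at hs hb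
  have := (abs_le.1 hl1).1
  nlinarith

lemma liminf_le_liminf_iterate (h : IsSubadditiveCocycle f φ C) (hC : 0 ≤ C) (x : X) (i : ℕ) :
    liminf (fun n : ℕ => φ n x / n) atTop ≤ liminf (fun n : ℕ => φ n (f^[i] x) / n) atTop := by
  induction i with
  | zero => simp
  | succ i ih =>
    rw [Function.iterate_succ_apply']
    exact ih.trans (h.liminf_le_liminf_apply hC _)

/-- The orbit is cut greedily: at a point outside B by a block of length at most N on which φ is
almost as small as the liminf predicts, at a point of B by a single step. The single step costs the
surcharge 2C, and the unfinished tail of length at most N costs 2CN. -/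
lemma le_sum_add (h : IsSubadditiveCocycle f φ C) (hC : 0 ≤ C) {ε : ℝ} (hε : 0 < ε) {N : ℕ}
    {B : Set X} (hB : ∀ x ∉ B, ∃ n : ℕ, 0 < n ∧ n ≤ N ∧
      φ n x ≤ n * (liminf (fun n : ℕ => φ n x / n) atTop + ε)) (n : ℕ) (x : X) :
    φ n x ≤ (∑ i ∈ Finset.range n, (liminf (fun n : ℕ => φ n (f^[i] x) / n) atTop + ε +
      B.indicator (fun _ => 2 * C) (f^[i] x))) + 2 * C * N := by
  induction n using Nat.strong_induction_on generalizing x with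
  | _ n ih =>
  have hind : ∀ y, 0 ≤ B.indicator (fun _ => 2 * C) y := fun y =>
    Set.indicator_nonneg (fun _ _ => by positivity) y
  rcases le_or_gt n N with hnN | hnN
  · have h1 := (abs_le.1 (h.bound n x)).2
    have h2 : ∑ i ∈ Finset.range n, (-C) ≤
        ∑ i ∈ Finset.range n, (liminf (fun n : ℕ => φ n (f^[i] x) / n) atTop + ε +
      B.indicator (fun _ => 2 * C) (f^[i] x)) := Finset.sum_le_sum fun i _ => by
        have := (abs_le.1 (h.abs_liminf_le hC (f^[i] x))).1
        have := hind (f^[i] x)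
        linarith
    simp only [Finset.sum_const, Finset.card_range, nsmul_eq_mul] at h2
    have : C * n ≤ C * N := by gcongr
    nlinarith
  -- A good initial block of length r reduces the claim to the orbit segment of length n - r.
  · have step : ∀ r, 0 < r → r ≤ n → φ r x ≤ ∑ i ∈ Finset.range r,
        (liminf (fun n : ℕ => φ n (f^[i] x) / n) atTop + ε +
          B.indicator (fun _ => 2 * C) (f^[i] x)) →
        φ n x ≤ (∑ i ∈ Finset.range n, (liminf (fun n : ℕ => φ n (f^[i] x) / n) atTop + ε +
          B.indicator (fun _ => 2 * C) (f^[i] x))) + 2 * C * N := by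
      intro r hr hrn hle
      have h1 := h.subadd r (n - r) x
      have h2 := ih (n - r) (by omega) (f^[r] x)
      rw [Nat.add_sub_cancel' hrn] at h1
      have h3 := Finset.sum_range_add (fun i =>
        (liminf (fun n : ℕ => φ n (f^[i] x) / n) atTop + ε +
          B.indicator (fun _ => 2 * C) (f^[i] x))) r (n - r)
      rw [Nat.add_sub_cancel' hrn] at h3
      rw [h3]
      simp only [← Function.iterate_add_apply] at h2
      simp only [add_comm r] at *
      linarith
    by_cases hx : x ∈ B
    · refine step 1 one_pos (by omega) ?_
      have h1 := (abs_le.1 (h.bound 1 x)).2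
      have h2 := (abs_le.1 (h.abs_liminf_le hC x)).1
      simp [hx] at h1 ⊢
      linarith
    · obtain ⟨r, hr0, hrN, hr⟩ := hB x hx
      refine step r hr0 (by omega) (hr.trans ?_)
      -- The liminf does not decrease along the orbit, so its value at x may be replaced by its
      -- values at the successive points of the block.
      have : ∑ i ∈ Finset.range r, (liminf (fun n : ℕ => φ n x / n) atTop + ε) ≤
          ∑ i ∈ Finset.range r, (liminf (fun n : ℕ => φ n (f^[i] x) / n) atTop + ε +
          B.indicator (fun _ => 2 * C) (f^[i] x)) := Finset.sum_le_sum fun i _ => by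
        have := h.liminf_le_liminf_iterate hC x i
        have := hind (f^[i] x)
        linarith
      simpa only [Finset.sum_const, Finset.card_range, nsmul_eq_mul] using this

/-- The pointwise covering bound is integrated and divided by n. The points that need a block longer
than N form sets decreasing to the empty set, so their contribution vanishes as N grows. -/
lemma le_integral_liminf (h : IsSubadditiveCocycle f φ C) (hC : 0 ≤ C) {μ : Measure X}
    [IsProbabilityMeasure μ] (hf : MeasurePreserving f μ μ) {L : ℝ}
    (hL : ∀ n : ℕ, n * L ≤ ∫ x, φ n x ∂μ) :
    L ≤ ∫ x, liminf (fun n : ℕ => φ n x / n) atTop ∂μ := by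
  set g : X → ℝ := fun x => liminf (fun n : ℕ => φ n x / n) atTop with hg
  have hgm : Measurable g := h.measurable_liminf
  have hgi : Integrable g μ := h.integrable_liminf hC μ
  refine le_of_forall_pos_le_add fun ε hε => ?_
  let B : ℕ → Set X := fun N => {x | ∃ n : ℕ, 0 < n ∧ n ≤ N ∧ φ n x ≤ n * (g x + ε)}ᶜ
  have hBm : ∀ N, MeasurableSet (B N) := by
    intro N
    refine MeasurableSet.compl ?_
    have : {x | ∃ n : ℕ, 0 < n ∧ n ≤ N ∧ φ n x ≤ n * (g x + ε)} =
        ⋃ n ∈ Finset.Icc 1 N, {x | φ n x ≤ n * (g x + ε)} := by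
      ext x
      simp only [Set.mem_ofPred_eq, Finset.mem_Icc, Set.mem_iUnion, exists_prop]
      exact exists_congr fun n => by rw [and_assoc]; rfl
    rw [this]
    exact Finset.measurableSet_biUnion _ fun n _ =>
      measurableSet_le (h.measurable n) ((hgm.add_const ε).const_mul _)
  have hBanti : Antitone B := fun M N hMN => Set.compl_subset_compl.2
    fun x ⟨n, h1, h2, h3⟩ => ⟨n, h1, h2.trans hMN, h3⟩
  have hBi : ⋂ N, B N = ∅ := by
    refine Set.eq_empty_of_forall_notMem fun x hx => ?_
    obtain ⟨n, hn, hle⟩ := h.exists_le_of_liminf hC hε x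
    exact Set.mem_iInter.1 hx n ⟨n, hn, le_rfl, hle⟩
  have hBt : Tendsto (fun N => μ.real (B N)) atTop (𝓝 0) := by
    have := tendsto_measure_iInter_atTop (μ := μ) (fun N => (hBm N).nullMeasurableSet) hBanti
      ⟨0, measure_ne_top _ _⟩
    rw [hBi, measure_empty] at this
    exact (ENNReal.tendsto_toReal ENNReal.zero_ne_top).comp this
  have key : ∀ N, L ≤ ∫ x, g x ∂μ + ε + 2 * C * μ.real (B N) := by
    intro N
    have hψi : Integrable (fun x => g x + ε + (B N).indicator (fun _ => 2 * C) x) μ :=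
      (hgi.add (integrable_const ε)).add ((integrable_const _).indicator (hBm N))
    have hψ : ∫ x, (g x + ε + (B N).indicator (fun _ => 2 * C) x) ∂μ =
        ∫ x, g x ∂μ + ε + 2 * C * μ.real (B N) := by
      rw [integral_add (f := fun x => g x + ε) (hgi.add (integrable_const ε))
        ((integrable_const _).indicator (hBm N)),
        integral_add hgi (integrable_const ε), integral_indicator_const _ (hBm N)]
      simp [mul_comm]
    have hn : ∀ n : ℕ, n * L ≤ n * (∫ x, g x ∂μ + ε + 2 * C * μ.real (B N)) + 2 * C * N := by
      intro n
      refine (hL n).trans ?_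
      have hii : ∀ i, Integrable (fun x => g (f^[i] x) + ε +
          (B N).indicator (fun _ => 2 * C) (f^[i] x)) μ := fun i =>
        ((hf.iterate i).integrable_comp hψi.aestronglyMeasurable).2 hψi
      calc ∫ x, φ n x ∂μ ≤ ∫ x, ((∑ i ∈ Finset.range n, (g (f^[i] x) + ε +
          (B N).indicator (fun _ => 2 * C) (f^[i] x))) + 2 * C * N) ∂μ := by
            refine integral_mono (h.integrable μ n)
              ((integrable_finsetSum _ fun i _ => hii i).add (integrable_const _)) fun x => ?_
            exact h.le_sum_add hC hε (fun y hy => not_not.1 hy) n x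
        _ = _ := by
            rw [integral_add (integrable_finsetSum _ fun i _ => hii i) (integrable_const _),
              integral_finsetSum _ fun i _ => hii i]
            have : ∀ i, ∫ x, (g (f^[i] x) + ε +
                (B N).indicator (fun _ => 2 * C) (f^[i] x)) ∂μ =
                ∫ x, g x ∂μ + ε + 2 * C * μ.real (B N) := by
              intro i
              rw [← hψ]
              conv_rhs => rw [← (hf.iterate i).map_eq]
              rw [integral_map (hf.iterate i).aemeasurable]
              rw [(hf.iterate i).map_eq]
              exact hψi.aestronglyMeasurable
            simp [this, mul_add]
    -- The error 2CN does not depend on n, so a large n refutes a strict reverse inequality.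
    by_contra hlt
    push Not at hlt
    obtain ⟨n, hn'⟩ := exists_nat_gt (2 * C * N / (L - (∫ x, g x ∂μ + ε + 2 * C * μ.real (B N))))
    rw [div_lt_iff₀ (by linarith)] at hn'
    have := hn n
    nlinarith
  have := ge_of_tendsto' ((hBt.const_mul (2 * C)).const_add (∫ x, g x ∂μ + ε)) key
  simpa using this

/-- Birkhoff sums of φ k under the k-th iterate are additive, so their negatives also form a
subadditive cocycle. The lower bound for the liminf, applied to these negatives, becomes an upper
bound for the limsup of φ. -/
lemma integral_limsup_le (h : IsSubadditiveCocycle f φ C) (hC : 0 ≤ C) {μ : Measure X}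
    [IsProbabilityMeasure μ] (hf : MeasurePreserving f μ μ) {k : ℕ} (hk : 0 < k) :
    ∫ x, limsup (fun n : ℕ => φ n x / n) atTop ∂μ ≤ (∫ x, φ k x ∂μ) / k := by
  have hk' : (0 : ℝ) < k := by exact_mod_cast hk
  let ψ : ℕ → X → ℝ := fun j x => -∑ i ∈ Finset.range j, φ k ((f^[k])^[i] x)
  have hfk := hf.iterate k
  have hψ : IsSubadditiveCocycle f^[k] ψ (C * k) := by
    refine ⟨fun n => ?_, fun n x => ?_, fun m n x => ?_⟩
    · exact (Finset.measurable_sum _ fun i _ =>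
        (h.measurable k).comp (hfk.iterate i).measurable).neg
    · simp only [ψ, abs_neg]
      calc |∑ i ∈ Finset.range n, φ k ((f^[k])^[i] x)|
          ≤ ∑ i ∈ Finset.range n, |φ k ((f^[k])^[i] x)| := Finset.abs_sum_le_sum_abs _ _
        _ ≤ ∑ i ∈ Finset.range n, C * k := Finset.sum_le_sum fun i _ => h.bound _ _
        _ = C * k * n := by simp [mul_comm]
    · simp only [ψ, Finset.sum_range_add, neg_add, ← Function.iterate_add_apply]
      simp only [add_comm m]
      exact le_rfl
  have hCk : 0 ≤ C * k := by positivity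
  have hint : ∀ n : ℕ, n * (-∫ x, φ k x ∂μ) ≤ ∫ x, ψ n x ∂μ := by
    intro n
    have hi : ∀ i, ∫ x, φ k ((f^[k])^[i] x) ∂μ = ∫ x, φ k x ∂μ := fun i => by
      conv_rhs => rw [← (hfk.iterate i).map_eq]
      rw [integral_map (hfk.iterate i).aemeasurable (h.measurable k).aestronglyMeasurable]
    simp only [ψ]
    rw [integral_neg, integral_finsetSum]
    · simp [hi]
    · exact fun i _ => ((hfk.iterate i).integrable_comp
        (h.measurable k).aestronglyMeasurable).2 (h.integrable μ k)
  have hlow := hψ.le_integral_liminf hCk hfk hint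
  have hmul : ∀ j x, φ (k * j) x ≤ -ψ j x := by
    intro j x
    induction j with
    | zero =>
      have := h.bound 0 x
      have h0 : φ 0 x = 0 := by simpa using this
      simp [ψ, h0]
    | succ j ih =>
      have := h.subadd (k * j) k x
      simp only [ψ, neg_neg, Finset.sum_range_succ] at ih ⊢
      rw [← Function.iterate_mul]
      rw [mul_add, mul_one]
      linarith
  have hpt : ∀ x, limsup (fun n : ℕ => φ n x / n) atTop ≤
      -(liminf (fun j : ℕ => ψ j x / j) atTop) / k := by
    intro x
    set l := liminf (fun j : ℕ => ψ j x / j) atTop with hl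
    refine le_of_forall_pos_le_add fun ε hε => ?_
    have hev := eventually_lt_of_lt_liminf (b := l - k * ε)
      (f := atTop) (u := fun j : ℕ => ψ j x / j) (by rw [← hl]; nlinarith) (hψ.isBounded_ge hCk x)
    -- Each time n splits into n / k blocks of length k and a remainder that costs at most C * k.
    have hdiv : Tendsto (fun n : ℕ => n / k) atTop atTop := Nat.tendsto_div_const_atTop hk.ne'
    have hdivr : Tendsto (fun n : ℕ => ((n / k : ℕ) : ℝ) / n) atTop (𝓝 (1 / k)) := by
      have hh := (tendsto_nat_floor_mul_div_atTop (R := ℝ) (a := 1 / k) (by positivity)).comp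
        tendsto_natCast_atTop_atTop
      refine hh.congr fun n => ?_
      simp only [Function.comp]
      rw [one_div, inv_mul_eq_div, Nat.floor_div_natCast, Nat.floor_natCast]
    have hlim : Tendsto (fun n : ℕ => -(((n / k : ℕ) : ℝ) / n) * (l - k * ε) + C * k / n) atTop
        (𝓝 (-l / k + ε)) := by
      have := (hdivr.neg.mul_const (l - k * ε)).add (tendsto_const_div_atTop_nhds_zero_nat (C * k))
      convert this using 2
      field_simp
      ring
    rw [← hlim.limsup_eq]
    refine limsup_le_limsup ?_ (h.isBounded_ge hC x).isCoboundedUnder_le hlim.isBoundedUnder_le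
    filter_upwards [hdiv.eventually hev, hdiv.eventually (eventually_gt_atTop 0),
      eventually_gt_atTop 0] with n hn hn1 hn0
    have hn0' : (0 : ℝ) < n := by exact_mod_cast hn0
    have hn1' : (0 : ℝ) < (n / k : ℕ) := by exact_mod_cast hn1
    rw [lt_div_iff₀ hn1'] at hn
    have h1 := h.subadd (k * (n / k)) (n % k) x
    rw [Nat.div_add_mod] at h1
    have h2 := hmul (n / k) x
    have h3 := (abs_le.1 (h.bound (n % k) (f^[k * (n / k)] x))).2
    have h4 : C * (n % k : ℕ) ≤ C * k := by
      gcongr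
      exact (Nat.mod_lt _ hk).le
    rw [div_le_iff₀ hn0']
    have : (-(((n / k : ℕ) : ℝ) / n) * (l - k * ε) + C * k / n) * n =
        -((n / k : ℕ) : ℝ) * (l - k * ε) + C * k := by field_simp
    rw [this]
    linarith
  have h5 : ∫ x, limsup (fun n : ℕ => φ n x / n) atTop ∂μ ≤
      ∫ x, -(liminf (fun j : ℕ => ψ j x / j) atTop) / k ∂μ :=
    integral_mono (h.integrable_limsup hC μ)
      ((hψ.integrable_liminf hCk μ).neg.div_const _) hpt
  refine h5.trans ?_
  rw [integral_div, integral_neg]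
  gcongr
  linarith

/-- Kingman's subadditive ergodic theorem for sequences of at most linear growth. -/
theorem kingman (h : IsSubadditiveCocycle f φ C) (hC : 0 ≤ C) {μ : Measure X}
    [IsProbabilityMeasure μ] (hf : MeasurePreserving f μ μ) :
    (∀ᵐ x ∂μ, Tendsto (fun n : ℕ => φ n x / n) atTop
      (𝓝 (limsup (fun n : ℕ => φ n x / n) atTop))) ∧
    ∫ x, limsup (fun n : ℕ => φ n x / n) atTop ∂μ =
      ⨅ n : ℕ, (∫ x, φ (n + 1) x ∂μ) / (n + 1 : ℕ) := by
  have hbdd : BddBelow (Set.range fun n : ℕ => (∫ x, φ (n + 1) x ∂μ) / (n + 1 : ℕ)) :=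
    ⟨_, Set.forall_mem_range.2 fun n => h.integral_limsup_le hC hf n.succ_pos⟩
  have hup : ∫ x, limsup (fun n : ℕ => φ n x / n) atTop ∂μ ≤
      ⨅ n : ℕ, (∫ x, φ (n + 1) x ∂μ) / (n + 1 : ℕ) :=
    le_ciInf fun n => h.integral_limsup_le hC hf n.succ_pos
  have hlow := h.le_integral_liminf hC hf
    (L := ⨅ n : ℕ, (∫ x, φ (n + 1) x ∂μ) / (n + 1 : ℕ)) fun n => by
      rcases n with _ | n
      -- The linear bound forces φ 0 = 0.
      · have h0 : ∀ x, φ 0 x = 0 := fun x => by simpa using h.bound 0 x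
        simp [h0]
      · have := ciInf_le hbdd n
        rwa [le_div_iff₀ (by positivity), mul_comm] at this
  have hle : ∀ x, liminf (fun n : ℕ => φ n x / n) atTop ≤
      limsup (fun n : ℕ => φ n x / n) atTop := fun x =>
    liminf_le_limsup (h.isBounded_le hC x) (h.isBounded_ge hC x)
  have hmono := integral_mono (h.integrable_liminf hC μ) (h.integrable_limsup hC μ) hle
  have heq := (integral_eq_iff_of_ae_le (h.integrable_liminf hC μ) (h.integrable_limsup hC μ)
    (ae_of_all _ hle)).1 (le_antisymm hmono (hup.trans hlow))
  refine ⟨?_, le_antisymm hup (hlow.trans hmono)⟩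
  filter_upwards [heq] with x hx
  exact tendsto_of_liminf_eq_limsup hx rfl (h.isBounded_le hC x) (h.isBounded_ge hC x)

end IsSubadditiveCocycle

end Kingman

/-! ### Block entropies under an invariant measure. -/

section InvariantItinerary

variable {X : Type*} [MeasurableSpace X] {k : ℕ} {f : X → X} {P : X → Fin k}

lemma shannon_itinerary_comp_iterate {μ : Measure X} (hf : MeasurePreserving f μ μ)
    (hP : Measurable P) (m n : ℕ) :
    shannon μ (itinerary f P n ∘ f^[m]) = shannon μ (itinerary f P n) := by
  rw [← shannon_map μ (hf.measurable.iterate m) (measurable_itinerary hf.measurable hP n),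
    (hf.iterate m).map_eq]

lemma subadditive_shannon_itinerary {μ : Measure X} [IsProbabilityMeasure μ]
    (hf : MeasurePreserving f μ μ) (hP : Measurable P) :
    Subadditive fun n => shannon μ (itinerary f P n) := fun m n => by
  have := shannon_itinerary_add_le μ hf.measurable hP m n
  rwa [shannon_itinerary_comp_iterate hf hP] at this

lemma shannon_itinerary_zero (μ : Measure X) [IsProbabilityMeasure μ] :
    shannon μ (itinerary f P 0) = 0 := by
  have : ∀ w : Fin 0 → Fin k, itinerary f P 0 ⁻¹' {w} = Set.univ := fun w => by
    ext x; simp [Subsingleton.elim _ w]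
  simp [shannon, this]

lemma shannon_itinerary_mul_le {μ : Measure X} [IsProbabilityMeasure μ]
    (hf : MeasurePreserving f μ μ) (hP : Measurable P) (q j : ℕ) :
    shannon μ (itinerary f P (q * j)) ≤ j * shannon μ (itinerary f P q) := by
  induction j with
  | zero => simp [shannon_itinerary_zero]
  | succ j ih =>
    have := subadditive_shannon_itinerary hf hP (q * j) q
    simp only at this
    rw [mul_add, mul_one]
    push_cast
    linarith

lemma shannon_itinerary_one_le {μ : Measure X} [IsFiniteMeasure μ] (hP : Measurable P) :
    shannon μ (itinerary f P 1) ≤ shannon μ P := by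
  have : itinerary f P 1 = fun x _ => P x := by
    ext x i
    simp [itinerary]
  rw [this]
  exact shannon_comp_le μ hP fun a _ => a

lemma shannon_itinerary_le_mul {μ : Measure X} [IsProbabilityMeasure μ]
    (hf : MeasurePreserving f μ μ) (hP : Measurable P) (n : ℕ) :
    shannon μ (itinerary f P n) ≤ n * shannon μ P := by
  have h1 := shannon_itinerary_mul_le hf hP 1 n
  rw [one_mul] at h1
  exact h1.trans (by gcongr; exact shannon_itinerary_one_le hP)

end InvariantItinerary

lemma exists_pos_forall_negMulLog_le {η : ℝ} (hη : 0 < η) :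
    ∃ δ > 0, ∀ t : ℝ, |t| < δ → Real.negMulLog t ≤ η ∧ Real.negMulLog (1 - t) ≤ η := by
  have h0 : Tendsto Real.negMulLog (𝓝 0) (𝓝 0) := by
    simpa using Real.continuous_negMulLog.tendsto 0
  have h1 : Tendsto (fun t => Real.negMulLog (1 - t)) (𝓝 0) (𝓝 0) := by
    have : Continuous fun t : ℝ => Real.negMulLog (1 - t) :=
      Real.continuous_negMulLog.comp (continuous_const.sub continuous_id)
    simpa using this.tendsto 0
  obtain ⟨δ, hδ, h⟩ := Metric.eventually_nhds_iff.1
    ((h0.eventually_lt_const hη).and (h1.eventually_lt_const hη))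
  exact ⟨δ, hδ, fun t ht => ⟨(h (by simpa using ht)).1.le, (h (by simpa using ht)).2.le⟩⟩

/-! ### Goodwyn's inequality: metric entropy is at most topological entropy. -/

section Goodwyn

lemma exists_pos_separation {X : Type*} [MetricSpace X] [CompactSpace X] {k : ℕ} {Q : Fin k → Set X} (hQ : ∀ a, IsClosed (Q a))
    (hd : ∀ a b, a ≠ b → Disjoint (Q a) (Q b)) :
    ∃ δ > 0, ∀ a b, a ≠ b → ∀ x ∈ Q a, ∀ y ∈ Q b, δ ≤ dist x y := by
  have h : ∀ᶠ δ in 𝓝[>] (0 : ℝ), ∀ a b, a ≠ b → ∀ x ∈ Q a, ∀ y ∈ Q b, δ ≤ dist x y := by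
    rw [eventually_all]
    intro a
    rw [eventually_all]
    intro b
    rcases eq_or_ne a b with rfl | hab
    · simp
    · obtain ⟨r, hr, h⟩ := Metric.exists_pos_forall_lt_edist (hQ a).isCompact (hQ b) (hd a b hab)
      have : ∀ᶠ δ in 𝓝[>] (0 : ℝ), δ ≤ (r : ℝ) :=
        (eventually_le_nhds (show (0 : ℝ) < r by exact_mod_cast hr)).filter_mono nhdsWithin_le_nhds
      filter_upwards [this] with δ hδ _ x hx y hy
      have h1 := h x hx y hy
      rw [edist_nndist] at h1
      exact hδ.trans (by exact_mod_cast h1.le)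
  obtain ⟨δ, h1, h2⟩ := (h.and self_mem_nhdsWithin).exists
  exact ⟨δ, h2, h1⟩

/-- The entropy of the itineraries is bounded by the cardinality of a dynamical cover, up to the
entropy of the part of the partition where the cover does not determine the itinerary. -/
lemma shannon_itinerary_le_of_cover {X : Type*} [MetricSpace X] [MeasurableSpace X]
    [BorelSpace X] {f : X → X} (hf : Continuous f) {μ : Measure X}
    [IsProbabilityMeasure μ]
    (hμ : MeasurePreserving f μ μ) {k : ℕ} {P : X → Fin k}
    {Q : Fin k → Set X} {W : X → Fin (k + 1)} (hW : Measurable W)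
    (hW0 : ∀ x, W x = 0 → x ∈ Q (P x)) (hW1 : ∀ x, W x ≠ 0 → W x = (P x).succ)
    {δ : ℝ} (hδ : ∀ a b, a ≠ b → ∀ x ∈ Q a, ∀ y ∈ Q b, δ ≤ dist x y) {n : ℕ} {s : Finset X}
    (hs : IsDynCoverOf f Set.univ {p | dist p.1 p.2 < δ / 2} n s) :
    shannon μ (itinerary f P n) ≤ Real.log s.card + n * shannon μ W := by
  classical
  let z : Fin s.card → X := fun j => s.equivFin.symm j
  have hz : ∀ x, ∃ j : ℕ, ∃ hj : j < s.card, ∀ i < n, dist (f^[i] x) (f^[i] (z ⟨j, hj⟩)) < δ / 2 := by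
    intro x
    obtain ⟨y, hy, hxy⟩ := hs (Set.mem_univ x)
    refine ⟨s.equivFin ⟨y, hy⟩, Fin.is_lt _, fun i hi => ?_⟩
    have := mem_dynEntourage.1 hxy i hi
    simpa [z] using this
  -- Choosing the first centre that shadows x makes the choice measurable, since each shadowing
  -- condition is open.
  let J : X → Fin s.card := fun x => ⟨Nat.find (hz x), (Nat.find_spec (hz x)).1⟩
  have hJ : ∀ x, ∀ i < n, dist (f^[i] x) (f^[i] (z (J x))) < δ / 2 := fun x =>
    (Nat.find_spec (hz x)).2
  have hJm : Measurable J := by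
    have h1 : Measurable fun x => Nat.find (hz x) := by
      refine measurable_find hz fun j => ?_
      by_cases hj : j < s.card
      · have : {x | ∃ hj : j < s.card, ∀ i < n, dist (f^[i] x) (f^[i] (z ⟨j, hj⟩)) < δ / 2} =
            ⋂ i ∈ Finset.range n, {x | dist (f^[i] x) (f^[i] (z ⟨j, hj⟩)) < δ / 2} := by
          ext x; simp [hj]
        rw [this]
        refine Finset.measurableSet_biInter _ fun i _ => IsOpen.measurableSet ?_
        exact isOpen_lt ((hf.iterate i).dist continuous_const) continuous_const
      · simp [hj]
    refine measurable_to_countable' fun j => ?_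
    have : J ⁻¹' {j} = (fun x => Nat.find (hz x)) ⁻¹' {(j : ℕ)} := by
      ext x; simp only [J, Set.mem_preimage, Set.mem_singleton_iff, Fin.ext_iff]
    rw [this]
    exact h1 (measurableSet_singleton _)
  -- The symbol predicted by centre j at time i. The sets Q a are δ apart, so at most one of them
  -- comes within δ/2 of the centre's orbit. The default value is never used where the prediction
  -- matters.
  let c : Fin s.card → Fin n → Fin k := fun j i =>
    if h : ∃ a, ∃ y ∈ Q a, dist y (f^[i] (z j)) < δ / 2 then h.choose else P (z j)
  have hc : ∀ x (i : Fin n), W (f^[i] x) = 0 → c (J x) i = P (f^[i] x) := by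
    intro x i hx
    have h : ∃ a, ∃ y ∈ Q a, dist y (f^[i] (z (J x))) < δ / 2 :=
      ⟨_, _, hW0 _ hx, hJ x i i.2⟩
    simp only [c, dif_pos h]
    obtain ⟨y, hy, hd⟩ := h.choose_spec
    by_contra hne
    have h1 := hδ _ _ hne y hy _ (hW0 _ hx)
    have h2 := hJ x i i.2
    have h3 := dist_triangle_right y (f^[i] x) (f^[i] (z (J x)))
    linarith
  have hWi := measurable_itinerary hμ.measurable hW n
  -- Where W vanishes the centre determines the symbol; elsewhere W records it directly.
  let Φ : Fin s.card × (Fin n → Fin (k + 1)) → Fin n → Fin k := fun p i =>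
    if h : p.2 i = 0 then c p.1 i else (p.2 i).pred h
  have hΦ : itinerary f P n = fun x => Φ (J x, itinerary f W n x) := by
    ext1 x
    ext1 i
    change P (f^[i] x) = if h : W (f^[i] x) = 0 then c (J x) i else (W (f^[i] x)).pred h
    by_cases h : W (f^[i] x) = 0
    · rw [dif_pos h, hc x i h]
    · have h' := hW1 _ h
      rw [dif_neg h, eq_comm]
      have : ∀ (w : Fin (k + 1)) (hw : w ≠ 0), w = (P (f^[i] x)).succ →
          w.pred hw = P (f^[i] x) := by
        rintro w hw rfl; simp
      exact this _ h h'
  rw [hΦ]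
  refine (shannon_comp_le μ (hJm.prodMk hWi) Φ).trans ((shannon_prod_le μ hJm hWi).trans ?_)
  have h1 := shannon_le_log_card μ hJm
  rw [Fintype.card_fin] at h1
  exact add_le_add h1 (shannon_itinerary_le_mul hμ hW n)

variable {X : Type*} [MetricSpace X] [CompactSpace X] [MeasurableSpace X] [BorelSpace X]

/-- A finite measurable partition is approximated from inside by compact sets, so that the
partition of the remainder has small entropy. -/
lemma exists_isClosed_shannon_le (μ : Measure X) [IsProbabilityMeasure μ] {k : ℕ} {P : X → Fin k}
    (hP : Measurable P) {η : ℝ} (hη : 0 < η) :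
    ∃ (Q : Fin k → Set X) (W : X → Fin (k + 1)), (∀ a, IsClosed (Q a)) ∧
      (∀ a, ∀ x ∈ Q a, P x = a) ∧ Measurable W ∧ (∀ x, W x = 0 → x ∈ Q (P x)) ∧
      (∀ x, W x ≠ 0 → W x = (P x).succ) ∧ shannon μ W ≤ η := by
  classical
  obtain ⟨δ, hδ, hδη⟩ := exists_pos_forall_negMulLog_le (η := η / (k + 1)) (by positivity)
  -- The k remainders together have measure below δ, and each of the k + 1 cells of W then
  -- contributes at most η / (k + 1).
  have hk : 0 < δ / (k + 1) := by positivity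
  have hm : ∀ a, MeasurableSet (P ⁻¹' {a}) := fun a => hP (measurableSet_singleton a)
  choose Q hQP hQc hQ using fun a => (hm a).exists_isClosed_sdiff_lt (μ := μ)
    (measure_ne_top _ _) (ε := ENNReal.ofReal (δ / (k + 1))) (by simpa using hk)
  have hQm : ∀ a, MeasurableSet (Q a) := fun a => (hQc a).measurableSet
  let W : X → Fin (k + 1) := fun x => if x ∈ Q (P x) then 0 else (P x).succ
  have hset : {x | x ∈ Q (P x)} = ⋃ a, Q a := by
    ext x
    simp only [Set.mem_ofPred_eq, Set.mem_iUnion]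
    exact ⟨fun h => ⟨_, h⟩, fun ⟨a, ha⟩ => by rwa [show P x = a from hQP a ha]⟩
  have hWm : Measurable W := by
    refine Measurable.ite ?_ measurable_const ((measurable_of_finite Fin.succ).comp hP)
    rw [hset]
    exact MeasurableSet.iUnion hQm
  have hWs : ∀ a : Fin k, W ⁻¹' {a.succ} = P ⁻¹' {a} \ Q a := by
    intro a
    ext x
    simp only [W, Set.mem_preimage, Set.mem_singleton_iff, Set.mem_sdiff]
    split_ifs with h
    · simp only [(Fin.succ_ne_zero a).symm, false_iff, not_and, not_not]
      rintro rfl; exact h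
    · rw [Fin.succ_inj]
      constructor
      · rintro rfl; exact ⟨rfl, h⟩
      · exact fun h => h.1
  have hsmall : ∀ a : Fin k, μ.real (W ⁻¹' {a.succ}) < δ / (k + 1) := by
    intro a
    rw [hWs, Measure.real]
    exact ENNReal.toReal_lt_of_lt_ofReal (hQ a)
  have hsum := sum_measureReal_fiber_univ μ hWm
  rw [Fin.sum_univ_succ] at hsum
  have hrest : ∑ a : Fin k, μ.real (W ⁻¹' {a.succ}) < δ := by
    have h1 : ∑ a : Fin k, μ.real (W ⁻¹' {a.succ}) ≤ ∑ a : Fin k, δ / (k + 1) :=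
      Finset.sum_le_sum fun a _ => (hsmall a).le
    have h2 : (k : ℝ) * (δ / (k + 1)) < δ := by
      rw [mul_div_assoc', div_lt_iff₀ (by positivity)]; nlinarith
    simp only [Finset.sum_const, Finset.card_univ, Fintype.card_fin, nsmul_eq_mul] at h1
    linarith
  have hnn : 0 ≤ ∑ a : Fin k, μ.real (W ⁻¹' {a.succ}) :=
    Finset.sum_nonneg fun _ _ => measureReal_nonneg
  refine ⟨Q, W, hQc, fun a x hx => hQP a hx, hWm, fun x hx => ?_, fun x hx => ?_, ?_⟩
  · by_contra h
    simp [W, h] at hx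
  · simp only [W] at hx ⊢
    split_ifs with h
    · simp [h] at hx
    · rfl
  · rw [shannon, Fin.sum_univ_succ]
    have h0 : Real.negMulLog (μ.real (W ⁻¹' {0})) ≤ η / (k + 1) := by
      rw [eq_sub_of_add_eq hsum]
      exact (hδη _ (by rwa [abs_of_nonneg hnn])).2
    have h1 : ∑ a : Fin k, Real.negMulLog (μ.real (W ⁻¹' {a.succ})) ≤
        ∑ a : Fin k, η / (k + 1) := Finset.sum_le_sum fun a _ => (hδη _ (by
          rw [abs_of_nonneg measureReal_nonneg]
          refine (hsmall a).trans_le (div_le_self hδ.le ?_)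
          have : (0 : ℝ) ≤ k := by positivity
          linarith)).1
    simp only [Finset.sum_const, Finset.card_univ, Fintype.card_fin, nsmul_eq_mul] at h1
    have : η / (k + 1) + k * (η / (k + 1)) = η := by field_simp; ring
    linarith

/-- Goodwyn's inequality for a partition. -/
lemma partitionEntropy_le_topEntropy {f : X → X} (hf : Continuous f) {μ : ProbabilityMeasure X}
    (hμ : μ ∈ invariantMeasures f) {k : ℕ} {P : X → Fin k} (hP : Measurable P) :
    partitionEntropy f μ P ≤ topEntropy f := by
  have : Nonempty X := μ.nonempty
  rw [← EReal.le_of_forall_lt_iff_le]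
  intro c hc
  -- The remainder costs η per unit time, and the cover at scale δ/2 costs less than c for large n.
  -- The scale depends on η, which is harmless because the topological entropy dominates every
  -- scale.
  have key : ∀ η > 0, partitionEntropy f μ P ≤ ((c + η : ℝ) : EReal) := by
    intro η hη
    obtain ⟨Q, W, hQc, hQP, hW, hW0, hW1, hWη⟩ :=
      exists_isClosed_shannon_le (μ : Measure X) hP hη
    obtain ⟨δ, hδ0, hδ⟩ := exists_pos_separation hQc fun a b hab =>
      Set.disjoint_left.2 fun x hx hy => hab ((hQP a x hx).symm.trans (hQP b x hy))
    have hU : {p : X × X | dist p.1 p.2 < δ / 2} ∈ uniformity X :=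
      Metric.dist_mem_uniformity (by positivity)
    have hlt := (coverEntropyEntourage_le_coverEntropy f Set.univ hU).trans_lt hc
    have hev := eventually_lt_of_limsup_lt hlt
    refine limsup_le_of_le (h := ?_)
    filter_upwards [hev, eventually_gt_atTop 0] with n hn hn0
    have hfin := coverMincard_finite_of_isCompact_invariant (T := f) isCompact_univ
      (Set.mapsTo_univ f Set.univ) hU n
    obtain ⟨s, hs, hcard⟩ := (coverMincard_finite_iff f Set.univ _ n).1 hfin
    have hs0 : 0 < s.card := by
      have := hs.nonempty Set.univ_nonempty
      exact Finset.card_pos.2 (by simpa using this)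
    have hn0' : (0 : ℝ) < n := by exact_mod_cast hn0
    have hle := shannon_itinerary_le_of_cover hf hμ hW hW0 hW1 hδ hs
    rw [← hcard] at hn
    have hlog : ENNReal.log (((s.card : ℕ∞)) : ENNReal) = (Real.log s.card : ℝ) := by
      rw [ENNReal.log_pos_real (by simpa using hs0.ne') (by simp)]
      simp
    rw [hlog] at hn
    have hn' : Real.log s.card / n < c := by
      rw [← EReal.coe_lt_coe_iff, EReal.coe_div]
      exact hn
    rw [div_lt_iff₀ hn0'] at hn'
    rw [EReal.coe_le_coe_iff, div_le_iff₀ hn0', joinEntropy_eq_shannon]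
    have : n * shannon (μ : Measure X) W ≤ n * η := by gcongr
    linarith
  rw [← EReal.le_of_forall_lt_iff_le]
  intro d hd
  have hd' : c < d := by exact_mod_cast hd
  simpa using key (d - c) (by linarith)

theorem metricEntropy_le_topEntropy {f : X → X} (hf : Continuous f) {μ : ProbabilityMeasure X}
    (hμ : μ ∈ invariantMeasures f) : metricEntropy f μ ≤ topEntropy f :=
  iSup_le fun _ => iSup_le fun _ => iSup_le fun hP => partitionEntropy_le_topEntropy hf hμ hP

end Goodwyn

/-! ### Averages of finitely many measures. -/

section MeanMeasure

variable {X ι : Type*} [MeasurableSpace X]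

/-- The arithmetic mean of a finite family of measures. -/
noncomputable def meanMeasure (s : Finset ι) (μ : ι → Measure X) : Measure X :=
  (s.card : ENNReal)⁻¹ • ∑ i ∈ s, μ i

lemma isProbabilityMeasure_meanMeasure {s : Finset ι} (hs : s.Nonempty) (μ : ι → Measure X)
    [∀ i, IsProbabilityMeasure (μ i)] : IsProbabilityMeasure (meanMeasure s μ) := by
  constructor
  simp only [meanMeasure, Measure.smul_apply, Measure.finsetSum_apply, measure_univ,
    Finset.sum_const, nsmul_eq_mul, mul_one, smul_eq_mul]
  exact ENNReal.inv_mul_cancel (by simpa using hs.card_pos.ne') (by simp)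

lemma meanMeasure_real (s : Finset ι) (μ : ι → Measure X) [∀ i, IsProbabilityMeasure (μ i)]
    (t : Set X) : (meanMeasure s μ).real t = ∑ i ∈ s, (s.card : ℝ)⁻¹ * (μ i).real t := by
  simp only [meanMeasure, Measure.real, Measure.smul_apply, Measure.finsetSum_apply, smul_eq_mul,
    ENNReal.toReal_mul, ENNReal.toReal_inv, ENNReal.toReal_natCast, ← Finset.mul_sum]
  rw [ENNReal.toReal_sum fun i _ => measure_ne_top _ _]

lemma integral_meanMeasure (s : Finset ι) (μ : ι → Measure X) {g : X → ℝ}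
    (hg : ∀ i, Integrable g (μ i)) :
    ∫ x, g x ∂(meanMeasure s μ) = (s.card : ℝ)⁻¹ * ∑ i ∈ s, ∫ x, g x ∂(μ i) := by
  rw [meanMeasure, integral_smul_measure, integral_finsetSum_measure fun i _ => hg i]
  simp

lemma sum_shannon_le_mul_shannon_meanMeasure {α : Type*} [Fintype α] {s : Finset ι}
    (hs : s.Nonempty) (μ : ι → Measure X) [∀ i, IsProbabilityMeasure (μ i)] (g : X → α) :
    ∑ i ∈ s, shannon (μ i) g ≤ s.card * shannon (meanMeasure s μ) g := by
  have h0 : (0 : ℝ) < s.card := by exact_mod_cast hs.card_pos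
  have := sum_mul_shannon_le s (fun _ => (s.card : ℝ)⁻¹) (fun _ _ => by positivity)
    (by simp [h0.ne']) μ (meanMeasure s μ) g fun a => meanMeasure_real s μ _
  rw [← Finset.mul_sum, inv_mul_le_iff₀ h0] at this
  exact this

/-- A map that is injective on a finite set has maximal entropy for the uniform measure. -/
lemma log_card_le_shannon_meanMeasure_dirac {α : Type*} [Fintype α] [MeasurableSpace α]
    [MeasurableSingletonClass α] {s : Finset X} (hs : s.Nonempty) {g : X → α} (hg : Measurable g)
    (hinj : Set.InjOn g s) :
    Real.log s.card ≤ shannon (meanMeasure s Measure.dirac) g := by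
  classical
  have h0 : (0 : ℝ) < s.card := by exact_mod_cast hs.card_pos
  have hval : ∀ x ∈ s, (meanMeasure s Measure.dirac).real (g ⁻¹' {g x}) = (s.card : ℝ)⁻¹ := by
    intro x hx
    rw [meanMeasure_real, Finset.sum_eq_single_of_mem x hx]
    · simp [Measure.real, Measure.dirac_apply' x (hg (measurableSet_singleton (g x)))]
    · intro y hy hne
      rw [Measure.real, Measure.dirac_apply' y (hg (measurableSet_singleton (g x)))]
      have : g y ≠ g x := fun h => hne (hinj hy hx h)
      simp [this]
  have := isProbabilityMeasure_meanMeasure hs (Measure.dirac (α := X))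
  calc Real.log s.card = ∑ x ∈ s, Real.negMulLog (s.card : ℝ)⁻¹ := by
        simp only [Finset.sum_const, nsmul_eq_mul, Real.negMulLog, Real.log_inv]
        field_simp
    _ = ∑ x ∈ s, Real.negMulLog ((meanMeasure s Measure.dirac).real (g ⁻¹' {g x})) :=
        Finset.sum_congr rfl fun x hx => by rw [hval x hx]
    _ = ∑ a ∈ s.image g, Real.negMulLog ((meanMeasure s Measure.dirac).real (g ⁻¹' {a})) :=
        (Finset.sum_image (f := fun a =>
          Real.negMulLog ((meanMeasure s Measure.dirac).real (g ⁻¹' {a}))) hinj).symm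
    _ ≤ shannon (meanMeasure s Measure.dirac) g :=
        Finset.sum_le_sum_of_subset_of_nonneg (Finset.subset_univ _) fun _ _ _ =>
          Real.negMulLog_nonneg measureReal_nonneg measureReal_le_one

end MeanMeasure

/-! ### Long blocks against averaged short blocks. -/

section BlockBound

variable {X : Type*} [MeasurableSpace X] {k : ℕ} {f : X → X} {P : X → Fin k}

lemma shannon_itinerary_comp_le (σ : Measure X) [IsProbabilityMeasure σ] (hf : Measurable f)
    (hP : Measurable P) (i n : ℕ) :
    shannon σ (itinerary f P n ∘ f^[i]) ≤ n * Real.log k := by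
  rw [← shannon_map σ (hf.iterate i) (measurable_itinerary hf hP n)]
  have := Measure.isProbabilityMeasure_map (μ := σ) (hf.iterate i).aemeasurable
  exact shannon_itinerary_le _ hf hP n

/-- After an initial stretch of length j, estimated trivially, the orbit is cut into R blocks of
length q. -/
lemma shannon_itinerary_add_mul_le (σ : Measure X) [IsProbabilityMeasure σ] (hf : Measurable f)
    (hP : Measurable P) (j q R : ℕ) :
    shannon σ (itinerary f P (j + R * q)) ≤
      j * Real.log k + ∑ r ∈ Finset.range R, shannon σ (itinerary f P q ∘ f^[r * q + j]) := by
  induction R with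
  | zero =>
    rw [zero_mul, add_zero, Finset.sum_range_zero, add_zero]
    exact shannon_itinerary_le σ hf hP j
  | succ R ih =>
    have := shannon_itinerary_add_le σ hf hP (j + R * q) q
    rw [Finset.sum_range_succ, add_mul, one_mul, ← add_assoc, add_comm (R * q) j]
    linarith

/-- The progressions of step q started at the q different phases list each time below R * q exactly
once; this permits averaging over phases. -/
lemma sum_range_sum_range_mul_add (g : ℕ → ℝ) (q R : ℕ) :
    ∑ j ∈ Finset.range q, ∑ r ∈ Finset.range R, g (r * q + j) =
      ∑ i ∈ Finset.range (R * q), g i := by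
  rw [Finset.sum_comm]
  induction R with
  | zero => simp
  | succ R ih => rw [Finset.sum_range_succ, ih, add_mul, one_mul, Finset.sum_range_add]

/-- The entropy of long itineraries is bounded by the average of the entropies of shorter
blocks. -/
lemma mul_shannon_itinerary_le (σ : Measure X) [IsProbabilityMeasure σ] (hf : Measurable f)
    (hP : Measurable P) {q : ℕ} (hq : 0 < q) (n : ℕ) :
    q * shannon σ (itinerary f P n) ≤
      ∑ i ∈ Finset.range n, shannon σ (itinerary f P q ∘ f^[i]) + 2 * q ^ 2 * Real.log k := by
  have hlog : 0 ≤ Real.log k := Real.log_natCast_nonneg k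
  -- With this R the blocks cover time n for every phase and overshoot by at most q.
  set R := n / q + 1
  have hR : n ≤ R * q := by
    have := Nat.lt_div_mul_add (a := n) hq
    simp only [R, add_mul, one_mul]; omega
  have hR' : R * q ≤ n + q := by
    have := Nat.div_mul_le_self n q
    simp only [R, add_mul, one_mul]; omega
  have h1 : ∑ j ∈ Finset.range q, shannon σ (itinerary f P n) ≤
      ∑ j ∈ Finset.range q, (q * Real.log k +
        ∑ r ∈ Finset.range R, shannon σ (itinerary f P q ∘ f^[r * q + j])) := by
    refine Finset.sum_le_sum fun j hj => ?_
    refine (shannon_itinerary_mono σ hf hP (by omega : n ≤ j + R * q)).trans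
      ((shannon_itinerary_add_mul_le σ hf hP j q R).trans ?_)
    have : (j : ℝ) ≤ q := by exact_mod_cast (Finset.mem_range.1 hj).le
    gcongr
  rw [Finset.sum_add_distrib,
    sum_range_sum_range_mul_add (fun i => shannon σ (itinerary f P q ∘ f^[i]))] at h1
  have h2 : ∑ i ∈ Finset.range (R * q), shannon σ (itinerary f P q ∘ f^[i]) ≤
      ∑ i ∈ Finset.range (n + q), shannon σ (itinerary f P q ∘ f^[i]) :=
    Finset.sum_le_sum_of_subset_of_nonneg (Finset.range_subset_range.2 hR')
      fun _ _ _ => shannon_nonneg _ _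
  rw [Finset.sum_range_add] at h2
  have h3 : ∑ i ∈ Finset.range q, shannon σ (itinerary f P q ∘ f^[n + i]) ≤
      ∑ i ∈ Finset.range q, q * Real.log k :=
    Finset.sum_le_sum fun i _ => shannon_itinerary_comp_le σ hf hP _ _
  simp only [Finset.sum_const, Finset.card_range, nsmul_eq_mul] at h1 h3
  nlinarith

/-- The average of the images of `σ` under the first `n` iterates of `f`. -/
noncomputable def orbitMean (f : X → X) (σ : Measure X) (n : ℕ) : Measure X :=
  meanMeasure (Finset.range n) fun i => σ.map f^[i]

lemma isProbabilityMeasure_orbitMean (hf : Measurable f) (σ : Measure X) [IsProbabilityMeasure σ]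
    {n : ℕ} (hn : 0 < n) : IsProbabilityMeasure (orbitMean f σ n) := by
  have := fun i => Measure.isProbabilityMeasure_map (μ := σ) (hf.iterate i).aemeasurable
  exact isProbabilityMeasure_meanMeasure (Finset.nonempty_range_iff.2 hn.ne') _

lemma mul_shannon_itinerary_le_orbitMean (σ : Measure X) [IsProbabilityMeasure σ]
    (hf : Measurable f) (hP : Measurable P) {q : ℕ} (hq : 0 < q) {n : ℕ} (hn : 0 < n) :
    q * shannon σ (itinerary f P n) ≤
      n * shannon (orbitMean f σ n) (itinerary f P q) + 2 * q ^ 2 * Real.log k := by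
  have := fun i => Measure.isProbabilityMeasure_map (μ := σ) (hf.iterate i).aemeasurable
  refine (mul_shannon_itinerary_le σ hf hP hq n).trans ?_
  have h := sum_shannon_le_mul_shannon_meanMeasure (Finset.nonempty_range_iff.2 hn.ne')
    (fun i => σ.map f^[i]) (itinerary f P q)
  simp only [shannon_map σ (hf.iterate _) (measurable_itinerary hf hP q), Finset.card_range] at h
  rw [orbitMean]
  linarith

end BlockBound

/-! ### Sets with null boundary. -/

section NullFrontier

variable {X : Type*} [TopologicalSpace X] [MeasurableSpace X] {μ : Measure X} {s t : Set X}

lemma measure_frontier_inter_eq_zero (hs : μ (frontier s) = 0) (ht : μ (frontier t) = 0) :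
    μ (frontier (s ∩ t)) = 0 :=
  measure_mono_null ((frontier_inter_subset s t).trans
    (Set.union_subset_union Set.inter_subset_left Set.inter_subset_right))
    (measure_union_null hs ht)

lemma measure_frontier_biInter_eq_zero {ι : Type*} (I : Finset ι) {s : ι → Set X}
    (hs : ∀ i ∈ I, μ (frontier (s i)) = 0) : μ (frontier (⋂ i ∈ I, s i)) = 0 := by
  classical
  induction I using Finset.induction_on with
  | empty => simp
  | insert i I hi ih =>
    rw [Finset.set_biInter_insert]
    exact measure_frontier_inter_eq_zero (hs i (Finset.mem_insert_self i I))
      (ih fun j hj => hs j (Finset.mem_insert_of_mem hj))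

lemma measure_frontier_itinerary_eq_zero {k : ℕ} [OpensMeasurableSpace X] {f : X → X}
    (hf : Continuous f)
    (hμ : MeasurePreserving f μ μ) {P : X → Fin k} (hP : ∀ a, μ (frontier (P ⁻¹' {a})) = 0)
    (q : ℕ) (w : Fin q → Fin k) : μ (frontier (itinerary f P q ⁻¹' {w})) = 0 := by
  have : itinerary f P q ⁻¹' {w} = ⋂ i ∈ (Finset.univ : Finset (Fin q)),
      f^[i] ⁻¹' (P ⁻¹' {w i}) := by
    ext x
    simp [itinerary, funext_iff]
  rw [this]
  refine measure_frontier_biInter_eq_zero _ fun i _ => ?_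
  refine measure_mono_null ((hf.iterate i).frontier_preimage_subset _) ?_
  rw [(hμ.iterate i).measure_preimage isClosed_frontier.nullMeasurableSet]
  exact hP _

end NullFrontier

/-! ### Misiurewicz's construction of invariant measures with large entropy. -/

section Misiurewicz

/-- Topological entropy is also computed by nets, whose dynamical balls are disjoint. Two net points
that stay U-close up to time n would have a common point in their balls. A limsup yields such nets
for infinitely many n only. -/
lemma exists_frequently_separated {X : Type*} [MetricSpace X] [CompactSpace X] {f : X → X} {c : ℝ} [Nonempty X]
    (hc : (c : EReal) < topEntropy f) :
    ∃ U ∈ uniformity X, ∃ᶠ n : ℕ in atTop, ∃ s : Finset X, s.Nonempty ∧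
      c * n ≤ Real.log s.card ∧
      ∀ x ∈ s, ∀ y ∈ s, (∀ i < n, (f^[i] x, f^[i] y) ∈ U) → x = y := by
  rw [topEntropy, coverEntropy_eq_iSup_netEntropyEntourage] at hc
  simp only [lt_iSup_iff] at hc
  obtain ⟨U, hU, hlt⟩ := hc
  refine ⟨U, hU, ?_⟩
  have hfr := frequently_lt_of_lt_limsup (by isBoundedDefault) hlt
  refine (hfr.and_eventually (eventually_gt_atTop 0)).mono fun n ⟨hn, hn0⟩ => ?_
  have hfin := (netMaxcard_le_coverMincard f Set.univ n).trans_lt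
    (coverMincard_finite_of_isCompact_invariant (T := f) isCompact_univ
      (Set.mapsTo_univ f Set.univ) hU n)
  obtain ⟨s, hs, hcard⟩ := (netMaxcard_finite_iff f Set.univ U n).1 hfin
  have h1 := (one_le_netMaxcard_iff f Set.univ U n).2 Set.univ_nonempty
  beta_reduce at hn
  rw [← hcard] at h1 hn
  have hs0 : 0 < s.card := by exact_mod_cast h1
  have hn0' : (0 : ℝ) < n := by exact_mod_cast hn0
  refine ⟨s, Finset.card_pos.1 hs0, ?_, fun x hx y hy hxy => ?_⟩
  · have hlog : ENNReal.log (((s.card : ℕ∞)) : ENNReal) = (Real.log s.card : ℝ) := by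
      rw [ENNReal.log_pos_real (by simpa using hs0.ne') (by simp)]
      simp
    rw [hlog] at hn
    have hn' : c < Real.log s.card / n := by
      rw [← EReal.coe_lt_coe_iff, EReal.coe_div]
      exact hn
    rw [lt_div_iff₀ hn0'] at hn'
    exact hn'.le
  · refine hs.2.elim_set hx hy y ?_ ?_
    · exact mem_ball_dynEntourage.2 fun i hi => hxy i hi
    · exact mem_ball_dynEntourage.2 fun i hi => refl_mem_uniformity hU

/-- A limit of orbit means is an invariant measure. -/
lemma mem_invariantMeasures_of_tendsto {X : Type*} [MetricSpace X] [MeasurableSpace X]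
    [BorelSpace X] {f : X → X} (hf : Continuous f) {σ : ℕ → Measure X}
    [∀ n, IsProbabilityMeasure (σ n)] {ρ : ℕ → ProbabilityMeasure X} {ν : ProbabilityMeasure X}
    {G : Filter ℕ} [G.NeBot] (hG : G ≤ atTop)
    (hρ : ∀ᶠ n in G, (ρ n : Measure X) = orbitMean f (σ n) n) (h : Tendsto ρ G (𝓝 ν)) :
    ν ∈ invariantMeasures f := by
  refine ⟨hf.measurable, ?_⟩
  have hmap := Measure.isProbabilityMeasure_map (μ := (ν : Measure X)) hf.measurable.aemeasurable
  refine ext_of_forall_integral_eq_of_IsFiniteMeasure fun g => ?_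
  rw [integral_map hf.measurable.aemeasurable g.continuous.aestronglyMeasurable]
  have h1 := ProbabilityMeasure.tendsto_iff_forall_integral_tendsto.1 h g
  have h2 := ProbabilityMeasure.tendsto_iff_forall_integral_tendsto.1 h
    (g.compContinuous ⟨f, hf⟩)
  have hz : Tendsto (fun n : ℕ => 2 * ‖g‖ / n) G (𝓝 0) :=
    (tendsto_const_div_atTop_nhds_zero_nat _).mono_left hG
  -- Along an orbit segment the sums of g ∘ f and of g telescope to two end terms, so their averages
  -- differ by at most 2‖g‖ / n.
  have h3 : Tendsto (fun n => ∫ x, (g.compContinuous ⟨f, hf⟩) x ∂(ρ n : Measure X) -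
      ∫ x, g x ∂(ρ n : Measure X)) G (𝓝 0) := by
    refine squeeze_zero_norm' ?_ hz
    filter_upwards [hρ, hG (eventually_gt_atTop 0)] with n hn hn0
    have hn0' : (0 : ℝ) < n := by exact_mod_cast hn0
    have := fun i => Measure.isProbabilityMeasure_map (μ := σ n)
      (hf.measurable.iterate i).aemeasurable
    have hmi : ∀ i, ∫ x, g x ∂((σ n).map f^[i]) = ∫ x, g (f^[i] x) ∂(σ n) := fun i =>
      integral_map (hf.measurable.iterate i).aemeasurable g.continuous.aestronglyMeasurable
    have hmi' : ∀ i, ∫ x, (g.compContinuous ⟨f, hf⟩) x ∂((σ n).map f^[i]) =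
        ∫ x, g (f^[i + 1] x) ∂(σ n) := fun i => by
      rw [integral_map (hf.measurable.iterate i).aemeasurable
        (BoundedContinuousFunction.continuous _).aestronglyMeasurable]
      simp [Function.iterate_succ_apply']
    rw [hn, orbitMean, integral_meanMeasure _ _ fun i => g.integrable _,
      integral_meanMeasure _ _ fun i => BoundedContinuousFunction.integrable _ _]
    simp only [hmi, hmi', ← mul_sub, ← Finset.sum_sub_distrib]
    rw [Finset.sum_range_sub (fun i => ∫ x, g (f^[i] x) ∂(σ n)), Finset.card_range, norm_mul,
      norm_inv, Real.norm_natCast, inv_mul_eq_div]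
    gcongr
    have hb : ∀ i, ‖∫ x, g (f^[i] x) ∂(σ n)‖ ≤ ‖g‖ := fun i => by
      have := norm_integral_le_of_norm_le_const (μ := σ n) (f := fun x => g (f^[i] x)) (C := ‖g‖)
        (ae_of_all _ fun x => g.norm_coe_le_norm _)
      simpa using this
    calc _ ≤ _ := norm_sub_le _ _
      _ ≤ ‖g‖ + ‖g‖ := add_le_add (hb _) (hb _)
      _ = 2 * ‖g‖ := by ring
  have h4 := tendsto_nhds_unique h3 (h2.sub h1)
  simp only [BoundedContinuousFunction.compContinuous_apply, ContinuousMap.coe_mk] at h4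
  linarith

variable {X : Type*} [MetricSpace X] [CompactSpace X] [MeasurableSpace X] [BorelSpace X]

/-- A compact metric space has finite partitions into small sets with null boundaries. -/
lemma exists_partition_null_frontier (μ : Measure X) [IsFiniteMeasure μ] {U : Set (X × X)}
    (hU : U ∈ uniformity X) :
    ∃ (k : ℕ) (P : X → Fin k), Measurable P ∧ (∀ x y, P x = P y → (x, y) ∈ U) ∧
      ∀ a, μ (frontier (P ⁻¹' {a})) = 0 := by
  classical
  obtain ⟨ε, hε, hεU⟩ := Metric.mem_uniformity_dist.1 hU
  have hr : ∀ x : X, ∃ r ∈ Set.Ioo 0 (ε / 2), μ (frontier (Metric.ball x r)) = 0 := by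
    intro x
    obtain ⟨r, hr, h⟩ := exists_null_frontier_thickening μ {x} (half_pos hε)
    exact ⟨r, hr, by rwa [Metric.thickening_singleton] at h⟩
  choose r hr hnull using hr
  obtain ⟨t, ht⟩ := isCompact_univ.elim_finite_subcover (fun x : X => Metric.ball x (r x))
    (fun x => Metric.isOpen_ball)
    (fun x _ => Set.mem_iUnion.2 ⟨x, Metric.mem_ball_self (hr x).1⟩)
  let z : Fin t.card → X := fun j => t.equivFin.symm j
  let D : ℕ → Set X := fun j =>
    if hj : j < t.card then Metric.ball (z ⟨j, hj⟩) (r (z ⟨j, hj⟩)) else ∅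
  have hDm : ∀ j, MeasurableSet (D j) := by
    intro j
    simp only [D]
    split_ifs
    · exact measurableSet_ball
    · exact MeasurableSet.empty
  have hDn : ∀ j, μ (frontier (D j)) = 0 := by
    intro j
    simp only [D]
    split_ifs
    · exact hnull _
    · simp
  have hlt : ∀ {j x}, x ∈ D j → j < t.card := by
    intro j x hx
    by_contra hj
    simp [D, hj] at hx
  have hcov : ∀ x, ∃ j, x ∈ D j := by
    intro x
    obtain ⟨y, hy, hxy⟩ := Set.mem_iUnion₂.1 (ht (Set.mem_univ x))
    refine ⟨t.equivFin ⟨y, hy⟩, ?_⟩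
    simpa [D, z] using hxy
  -- Each point gets the index of the first ball containing it, so the boundary of a cell lies in
  -- the boundaries of finitely many balls.
  let P : X → Fin t.card := fun x => ⟨Nat.find (hcov x), hlt (Nat.find_spec (hcov x))⟩
  have hP : ∀ a : Fin t.card, P ⁻¹' {a} = D a ∩ ⋂ j ∈ Finset.range a, (D j)ᶜ := by
    intro a
    ext x
    simp [P, Fin.ext_iff, Nat.find_eq_iff]
  refine ⟨t.card, P, ?_, ?_, ?_⟩
  · refine measurable_to_countable' fun a => ?_
    rw [hP]
    exact (hDm a).inter (Finset.measurableSet_biInter _ fun j _ => (hDm j).compl)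
  · intro x y hxy
    refine hεU ?_
    have hx : x ∈ P ⁻¹' {P y} := hxy
    have hy : y ∈ P ⁻¹' {P y} := rfl
    rw [hP] at hx hy
    have hx1 := hx.1
    have hy1 := hy.1
    simp only [D, Fin.is_lt, dif_pos, Metric.mem_ball] at hx1 hy1
    have h1 := dist_triangle_right x y (z (P y))
    have h2 := (hr (z (P y))).2
    simp only [Fin.eta] at hx1 hy1
    linarith
  · intro a
    rw [hP]
    refine measure_frontier_inter_eq_zero (hDn a) (measure_frontier_biInter_eq_zero _ fun j _ => ?_)
    rw [frontier_compl]
    exact hDn j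

/-- The lower bound in the variational principle, for a single partition. -/
theorem exists_invariant_shannon_ge {f : X → X} (hf : Continuous f) [Nonempty X] {c : ℝ}
    (hc : (c : EReal) < topEntropy f) :
    ∃ ν ∈ invariantMeasures f, ∃ (k : ℕ) (P : X → Fin k), Measurable P ∧
      ∀ q : ℕ, 0 < q → c * q ≤ shannon (ν : Measure X) (itinerary f P q) := by
  classical
  obtain ⟨U, hU, hfr⟩ := exists_frequently_separated hc
  let S : Set ℕ := {n | ∃ s : Finset X, s.Nonempty ∧ c * n ≤ Real.log s.card ∧
      ∀ x ∈ s, ∀ y ∈ s, (∀ i < n, (f^[i] x, f^[i] y) ∈ U) → x = y}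
  have hNB : (atTop ⊓ 𝓟 S).NeBot := frequently_mem_iff_neBot.1 hfr
  have hex : ∀ n, ∃ s : Finset X, s.Nonempty ∧ (n ∈ S → c * n ≤ Real.log s.card ∧
      ∀ x ∈ s, ∀ y ∈ s, (∀ i < n, (f^[i] x, f^[i] y) ∈ U) → x = y) := by
    intro n
    by_cases h : n ∈ S
    · obtain ⟨s, h1, h2⟩ := h
      exact ⟨s, h1, fun _ => h2⟩
    · exact ⟨{Classical.arbitrary X}, Finset.singleton_nonempty _, fun h' => absurd h' h⟩
  choose s hs hsS using hex
  let σ : ℕ → Measure X := fun n => meanMeasure (s n) Measure.dirac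
  have hσ : ∀ n, IsProbabilityMeasure (σ n) := fun n =>
    isProbabilityMeasure_meanMeasure (hs n) _
  let ρ : ℕ → ProbabilityMeasure X := fun n => if hn : 0 < n then
    ⟨orbitMean f (σ n) n, isProbabilityMeasure_orbitMean hf.measurable (σ n) hn⟩ else
    ⟨σ n, hσ n⟩
  -- An ultrafilter on the times with large separated sets makes the orbit means converge by
  -- compactness, with no extraction of subsequences.
  let G := Ultrafilter.of (atTop ⊓ 𝓟 S)
  have hGle : (G : Filter ℕ) ≤ atTop ⊓ 𝓟 S := Ultrafilter.of_le _
  have hG : (G : Filter ℕ) ≤ atTop := hGle.trans inf_le_left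
  have hGS : ∀ᶠ n in (G : Filter ℕ), n ∈ S := (hGle.trans inf_le_right) (mem_principal_self S)
  have hpos : ∀ᶠ n : ℕ in (G : Filter ℕ), 0 < n := hG (eventually_gt_atTop 0)
  obtain ⟨ν, -, hν⟩ := isCompact_univ.ultrafilter_le_nhds (G.map ρ) (by simp)
  have hρ : ∀ᶠ n in (G : Filter ℕ), (ρ n : Measure X) = orbitMean f (σ n) n := by
    filter_upwards [hpos] with n hn
    simp [ρ, hn]
  have hinv := mem_invariantMeasures_of_tendsto hf hG hρ hν
  -- The partition is chosen after ν, so that its cells have ν-null boundary and block entropies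
  -- pass to the limit. Points of a cell are U-close, so itineraries of length n separate the points
  -- of `s n`.
  obtain ⟨k, P, hP, hPU, hPn⟩ := exists_partition_null_frontier (ν : Measure X) hU
  refine ⟨ν, hinv, k, P, hP, fun q hq => ?_⟩
  have hlim : Tendsto (fun n => shannon (ρ n : Measure X) (itinerary f P q)) G
      (𝓝 (shannon (ν : Measure X) (itinerary f P q))) := by
    refine tendsto_finsetSum _ fun w _ => (Real.continuous_negMulLog.tendsto _).comp ?_
    exact (ENNReal.tendsto_toReal (measure_ne_top _ _)).comp
      (ProbabilityMeasure.tendsto_measure_of_null_frontier_of_tendsto' hν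
        (measure_frontier_itinerary_eq_zero hf hinv hPn q w))
  have hlim2 := hlim.add ((tendsto_const_div_atTop_nhds_zero_nat (2 * q ^ 2 * Real.log k)).mono_left
    hG)
  rw [add_zero] at hlim2
  refine ge_of_tendsto hlim2 ?_
  filter_upwards [hGS, hpos, hρ] with n hnS hn0 hn
  have hn0' : (0 : ℝ) < n := by exact_mod_cast hn0
  obtain ⟨h1, h2⟩ := hsS n hnS
  have hinj : Set.InjOn (itinerary f P n) (s n) := fun x hx y hy hxy => h2 x hx y hy fun i hi =>
    hPU _ _ (congrFun hxy ⟨i, hi⟩)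
  have h3 := log_card_le_shannon_meanMeasure_dirac (hs n)
    (measurable_itinerary hf.measurable hP n) hinj
  have h4 := mul_shannon_itinerary_le_orbitMean (σ n) hf.measurable hP hq hn0
  rw [← hn] at h4
  have h5 : c * n ≤ shannon (σ n) (itinerary f P n) := h1.trans h3
  have hq0 : (0 : ℝ) < q := by exact_mod_cast hq
  have h6 : q * (c * n) ≤ q * shannon (σ n) (itinerary f P n) := by gcongr
  rw [← sub_nonneg]
  have : shannon (ρ n : Measure X) (itinerary f P q) + 2 * q ^ 2 * Real.log k / n - c * q =
    (n * shannon (ρ n : Measure X) (itinerary f P q) + 2 * q ^ 2 * Real.log k - q * (c * n)) / n := by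
    field_simp
  rw [this]
  exact div_nonneg (by linarith) hn0'.le

end Misiurewicz

/-! ### Countable generating π-systems. -/

section PiSystem

/-- A countably generated σ-algebra is generated by a countable π-system. -/
lemma exists_countable_isPiSystem (X : Type*) [mX : MeasurableSpace X]
    [MeasurableSpace.CountablyGenerated X] :
    ∃ S : Set (Set X), S.Countable ∧ IsPiSystem S ∧ mX = MeasurableSpace.generateFrom S := by
  let b := MeasurableSpace.countableGeneratingSet X
  have hb : b.Countable := MeasurableSpace.countable_countableGeneratingSet
  refine ⟨Set.sInter '' {t | t.Finite ∧ t ⊆ b}, (Set.countable_ofPred_finite_subset hb).image _,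
    ?_, le_antisymm ?_ ?_⟩
  · rintro _ ⟨s, ⟨hs, hsb⟩, rfl⟩ _ ⟨t, ⟨ht, htb⟩, rfl⟩ -
    exact ⟨s ∪ t, ⟨hs.union ht, Set.union_subset hsb htb⟩, Set.sInter_union s t⟩
  · conv_lhs => rw [← MeasurableSpace.generateFrom_countableGeneratingSet (α := X)]
    refine MeasurableSpace.generateFrom_mono fun s hs => ⟨{s}, ⟨Set.finite_singleton s, ?_⟩, ?_⟩
    · simpa using hs
    · simp
  · refine MeasurableSpace.generateFrom_le ?_
    rintro _ ⟨s, ⟨hs, hsb⟩, rfl⟩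
    exact MeasurableSet.sInter hs.countable fun t ht =>
      MeasurableSpace.measurableSet_countableGeneratingSet (hsb ht)

end PiSystem

/-! ### Visit frequencies and a criterion for ergodicity. -/

section Visits

variable {X : Type*} {f : X → X} {s : Set X}

/-- The number of visits to `s` up to time `n`. -/
noncomputable def visits (f : X → X) (s : Set X) (n : ℕ) (x : X) : ℝ :=
  ∑ i ∈ Finset.range n, s.indicator 1 (f^[i] x)

lemma visits_nonneg (n : ℕ) (x : X) : 0 ≤ visits f s n x :=
  Finset.sum_nonneg fun _ _ => Set.indicator_nonneg (fun _ _ => zero_le_one) _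

lemma visits_succ (n : ℕ) (x : X) :
    visits f s (n + 1) x = visits f s n (f x) + s.indicator 1 x := by
  simp [visits, Finset.sum_range_succ']

lemma abs_visits_apply_sub_le (n : ℕ) (x : X) :
    |visits f s n (f x) - visits f s n x| ≤ 1 := by
  have h1 := visits_succ (f := f) (s := s) n x
  have h2 : visits f s (n + 1) x = visits f s n x + s.indicator 1 (f^[n] x) :=
    Finset.sum_range_succ _ _
  have h3 : ∀ y, s.indicator (1 : X → ℝ) y ≤ 1 := fun y =>
    Set.indicator_le_self' (f := (1 : X → ℝ)) (fun _ _ => zero_le_one) _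
  have h4 : ∀ y, 0 ≤ s.indicator (1 : X → ℝ) y := fun y =>
    Set.indicator_nonneg (fun _ _ => zero_le_one) _
  rw [abs_le]
  constructor <;> linarith [h3 x, h4 x, h3 (f^[n] x), h4 (f^[n] x)]

variable [MeasurableSpace X]

lemma isSubadditiveCocycle_visits (hf : Measurable f) (hs : MeasurableSet s) :
    IsSubadditiveCocycle f (visits f s) 1 := by
  refine ⟨fun n => ?_, fun n x => ?_, fun m n x => ?_⟩
  · exact Finset.measurable_sum _ fun i _ =>
      ((measurable_one.indicator hs).comp (hf.iterate i))
  · rw [abs_of_nonneg (visits_nonneg n x)]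
    refine (Finset.sum_le_card_nsmul _ _ 1 fun i _ => ?_).trans (by simp)
    exact Set.indicator_le_self' (f := (1 : X → ℝ)) (fun _ _ => zero_le_one) _
  · refine le_of_eq ?_
    simp only [visits]
    rw [Finset.sum_range_add]
    simp only [← Function.iterate_add_apply, add_comm m]

/-- The upper asymptotic frequency of visits to `s`. -/
noncomputable def visitFrequency (f : X → X) (s : Set X) (x : X) : ℝ :=
  limsup (fun n : ℕ => visits f s n x / n) atTop

/-- Visit counts from x and from f x differ by at most 1. Invariance therefore holds at every point,
which gives measurability for the invariant σ-algebra itself. -/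
lemma visitFrequency_apply (hf : Measurable f) (hs : MeasurableSet s) (x : X) :
    visitFrequency f s (f x) = visitFrequency f s x := by
  have hc := isSubadditiveCocycle_visits hf hs
  have hz : Tendsto (fun n : ℕ => visits f s n (f x) / n - visits f s n x / n) atTop (𝓝 0) := by
    refine squeeze_zero_norm (fun n => ?_) (tendsto_const_div_atTop_nhds_zero_nat 1)
    rw [← sub_div, norm_div, Real.norm_natCast, Real.norm_eq_abs]
    gcongr
    exact abs_visits_apply_sub_le n x
  have key : ∀ y z : X, Tendsto (fun n : ℕ => visits f s n y / n - visits f s n z / n)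
      atTop (𝓝 0) → visitFrequency f s y ≤ visitFrequency f s z := by
    intro y z h
    have := limsup_add_le (f := atTop) (u := fun n : ℕ => visits f s n z / n)
      (v := fun n : ℕ => visits f s n y / n - visits f s n z / n)
      (hc.isBounded_ge zero_le_one z) (hc.isBounded_le zero_le_one z)
      h.isBoundedUnder_ge.isCoboundedUnder_le h.isBoundedUnder_le
    rw [h.limsup_eq, add_zero] at this
    refine le_trans (le_of_eq ?_) this
    simp only [visitFrequency]
    congr 1
    ext n
    simp
  refine le_antisymm (key _ _ hz) (key _ _ ?_)
  simpa using hz.neg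

lemma measurable_visitFrequency (hf : Measurable f) (hs : MeasurableSet s) :
    Measurable[MeasurableSpace.invariants f] (visitFrequency f s) := by
  have hm : Measurable (visitFrequency f s) := (isSubadditiveCocycle_visits hf hs).measurable_limsup
  refine MeasurableSpace.measurable_invariants_dom.2 ⟨hm, fun t ht => ?_⟩
  ext x
  simp [visitFrequency_apply hf hs]

lemma integral_visits_restrict {ν : Measure X} [IsProbabilityMeasure ν]
    (hf : MeasurePreserving f ν ν) (hs : MeasurableSet s) {B : Set X} (hB : MeasurableSet B)
    (hBf : f ⁻¹' B = B) (n : ℕ) :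
    ∫ x in B, visits f s n x ∂ν = n * ν.real (s ∩ B) := by
  have hBi : ∀ i, f^[i] ⁻¹' B = B := fun i => by
    induction i with
    | zero => rfl
    | succ i ih => rw [Function.iterate_succ, Set.preimage_comp, ih, hBf]
  have hsi : ∀ i, MeasurableSet (f^[i] ⁻¹' s) := fun i => (hf.measurable.iterate i) hs
  have h1 : ∀ i x, s.indicator (1 : X → ℝ) (f^[i] x) = (f^[i] ⁻¹' s).indicator 1 x :=
    fun i x => rfl
  simp only [visits, h1]
  rw [integral_finsetSum]
  · have : ∀ i, ∫ x in B, (f^[i] ⁻¹' s).indicator (1 : X → ℝ) x ∂ν = ν.real (s ∩ B) := by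
      intro i
      rw [integral_indicator_one (hsi i), measureReal_restrict_apply (hsi i)]
      conv_lhs => rw [← hBi i, ← Set.preimage_inter]
      exact (hf.iterate i).measureReal_preimage (hs.inter hB).nullMeasurableSet
    simp [this]
  · exact fun i _ => (integrable_const (1 : ℝ)).indicator (hsi i)

/-- A measure is ergodic if the frequencies of visits to the sets of a generating π-system are
constant. -/
lemma ergodic_of_tendsto_visits {ν : Measure X} [IsProbabilityMeasure ν]
    (hf : MeasurePreserving f ν ν) {S : Set (Set X)} (hS : IsPiSystem S)
    (hgen : ‹MeasurableSpace X› = MeasurableSpace.generateFrom S)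
    (h : ∀ s ∈ S, ∃ c : ℝ, ∀ᵐ x ∂ν, Tendsto (fun n : ℕ => visits f s n x / n) atTop (𝓝 c)) :
    Ergodic f ν := by
  have hm : ∀ s ∈ S, MeasurableSet s := fun s hs => by
    rw [hgen]; exact MeasurableSpace.measurableSet_generateFrom hs
  refine ⟨hf, ⟨fun B hB hBf => ?_⟩⟩
  -- Integrating the constant limiting frequency over B and over the whole space shows that s and B
  -- are independent.
  have key : ∀ s ∈ S, ν.real (s ∩ B) = ν.real s * ν.real B := by
    intro s hs
    obtain ⟨c, hc⟩ := h s hs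
    have hcoc := isSubadditiveCocycle_visits hf.measurable (hm s hs)
    have hlim : ∀ D : Set X, MeasurableSet D → f ⁻¹' D = D → ν.real (s ∩ D) = c * ν.real D := by
      intro D hD hDf
      have h1 : Tendsto (fun n : ℕ => ∫ x in D, visits f s n x / n ∂ν) atTop
          (𝓝 (∫ x in D, c ∂ν)) := by
        refine tendsto_integral_of_dominated_convergence (fun _ => 1)
          (fun n => ((hcoc.measurable n).div_const _).aestronglyMeasurable) (integrable_const _)
          (fun n => ae_of_all _ fun x => hcoc.abs_div_le zero_le_one n x)
          (ae_restrict_of_ae hc)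
      have h2 : Tendsto (fun n : ℕ => ∫ x in D, visits f s n x / n ∂ν) atTop
          (𝓝 (ν.real (s ∩ D))) := by
        refine tendsto_const_nhds.congr' ?_
        filter_upwards [eventually_gt_atTop 0] with n hn
        have hn0 : (n : ℝ) ≠ 0 := by exact_mod_cast hn.ne'
        rw [integral_div, integral_visits_restrict hf (hm s hs) hD hDf]
        field_simp
      have := tendsto_nhds_unique h2 h1
      simpa [mul_comm] using this
    have h1 := hlim Set.univ MeasurableSet.univ rfl
    rw [Set.inter_univ, probReal_univ, mul_one] at h1
    rw [h1]
    exact hlim B hB hBf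
  -- Independence extends from the π-system to all measurable sets. Evaluation at B gives ν B = (ν
  -- B)², so B has measure 0 or 1.
  have hmeas : ν.restrict B = ν B • ν := by
    refine ext_of_generate_finite S hgen hS (fun s hs => ?_) (by simp)
    rw [Measure.restrict_apply (hm s hs), Measure.smul_apply, smul_eq_mul]
    have := key s hs
    rw [Measure.real, Measure.real, Measure.real, ← ENNReal.toReal_mul, mul_comm] at this
    exact (ENNReal.toReal_eq_toReal_iff' (measure_ne_top _ _)
      (ENNReal.mul_ne_top (measure_ne_top _ _) (measure_ne_top _ _))).1 this
  have h2 : ν B = ν B * ν B := by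
    have := congrArg (fun m => m B) hmeas
    simpa using this
  rw [eventuallyConst_set]
  by_cases h0 : ν B = 0
  · right
    exact measure_eq_zero_iff_ae_notMem.1 h0
  · left
    have h3 : ν B = 1 := by
      have := (ENNReal.mul_left_inj (a := 1) (b := ν B) h0 (measure_ne_top _ _)).1
        (by rw [one_mul]; exact h2)
      exact this.symm
    exact mem_ae_iff_prob_eq_one hB |>.2 h3

end Visits

/-! ### Ergodic decomposition by conditioning on invariant sets. -/

section ErgodicDecomposition

variable {X : Type*} [MeasurableSpace X] [StandardBorelSpace X] {f : X → X} {μ : Measure X}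
  [IsProbabilityMeasure μ]

/-- The ergodic components of an invariant measure. -/
noncomputable abbrev component (f : X → X) (μ : Measure X) [IsFiniteMeasure μ] (x : X) :
    Measure X :=
  ProbabilityTheory.condExpKernel μ (MeasurableSpace.invariants f) x

lemma setIntegral_component_real {s B : Set X} (hs : MeasurableSet s)
    (hB : MeasurableSet[MeasurableSpace.invariants f] B) :
    ∫ x in B, (component f μ x).real s ∂μ = μ.real (s ∩ B) := by
  have hle := MeasurableSpace.invariants_le f
  have h := ProbabilityTheory.condExpKernel_ae_eq_condExp (μ := μ) hle hs
  rw [integral_congr_ae (ae_restrict_of_ae h),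
    setIntegral_condExp hle ((integrable_const (1 : ℝ)).indicator hs) hB]
  rw [← measureReal_restrict_apply hs]
  exact integral_indicator_one hs

lemma measurable_component_real {s : Set X} (hs : MeasurableSet s) :
    Measurable[MeasurableSpace.invariants f] fun x => (component f μ x).real s :=
  (ProbabilityTheory.measurable_condExpKernel hs).ennreal_toReal

lemma ae_ae_component {p : X → Prop} (hp : ∀ᵐ x ∂μ, p x) :
    ∀ᵐ x ∂μ, ∀ᵐ y ∂(component f μ x), p y := by
  have hle := MeasurableSpace.invariants_le f
  have h := ProbabilityTheory.condExpKernel_comp_trim (μ := μ) hle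
  rw [← h] at hp
  exact ae_of_ae_trim hle (Measure.ae_ae_of_ae_comp hp)

lemma ae_component_mem_iff {B : Set X} (hB : MeasurableSet[MeasurableSpace.invariants f] B) :
    ∀ᵐ x ∂μ, ∀ᵐ y ∂(component f μ x), (y ∈ B ↔ x ∈ B) := by
  have hle := MeasurableSpace.invariants_le f
  have h := ProbabilityTheory.condExpKernel_ae_eq_condExp (μ := μ) hle (hle _ hB)
  have h2 : μ[B.indicator (fun _ => (1 : ℝ)) | MeasurableSpace.invariants f] =
      B.indicator fun _ => (1 : ℝ) :=
    condExp_of_stronglyMeasurable hle (stronglyMeasurable_const.indicator hB)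
      ((integrable_const (1 : ℝ)).indicator (hle _ hB))
  rw [h2] at h
  filter_upwards [h] with x hx
  by_cases hxB : x ∈ B
  · simp only [hxB, Set.indicator_of_mem, iff_true] at hx ⊢
    refine (mem_ae_iff_prob_eq_one (hle _ hB)).2 ?_
    rw [Measure.real, ENNReal.toReal_eq_one_iff] at hx
    exact hx
  · simp only [hxB, not_false_eq_true, Set.indicator_of_notMem, iff_false] at hx ⊢
    rw [Measure.real, ENNReal.toReal_eq_zero_iff] at hx
    exact measure_eq_zero_iff_ae_notMem.1 (hx.resolve_right (measure_ne_top _ _))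

/-- Invariant functions are constant on the ergodic components. -/
lemma ae_component_eq {g : X → ℝ} (hg : Measurable[MeasurableSpace.invariants f] g) :
    ∀ᵐ x ∂μ, ∀ᵐ y ∂(component f μ x), g y = g x := by
  have h : ∀ᵐ x ∂μ, ∀ q : ℚ, ∀ᵐ y ∂(component f μ x), (g y < q ↔ g x < q) :=
    ae_all_iff.2 fun q => ae_component_mem_iff (B := g ⁻¹' Set.Iio (q : ℝ)) (hg measurableSet_Iio)
  filter_upwards [h] with x hx
  filter_upwards [ae_all_iff.2 hx] with y hy
  refine le_antisymm (le_of_not_gt fun hlt => ?_) (le_of_not_gt fun hlt => ?_)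
  · obtain ⟨q, h1, h2⟩ := exists_rat_btwn hlt
    exact absurd ((hy q).2 h1) h2.not_gt
  · obtain ⟨q, h1, h2⟩ := exists_rat_btwn hlt
    exact absurd ((hy q).1 h1) h2.not_gt

/-- Both sides are measurable for the invariant σ-algebra and, as μ is invariant, have the same
integral over every invariant set. -/
lemma ae_component_preimage (hf : MeasurePreserving f μ μ) {s : Set X} (hs : MeasurableSet s) :
    ∀ᵐ x ∂μ, (component f μ x).real (f ⁻¹' s) = (component f μ x).real s := by
  have hle := MeasurableSpace.invariants_le f
  have hint : ∀ t : Set X, MeasurableSet t →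
      Integrable (fun x => (component f μ x).real t) (μ.trim hle) := fun t ht =>
    ((ProbabilityTheory.integrable_toReal_condExpKernel ht).trim hle
      (measurable_component_real ht).stronglyMeasurable)
  refine ae_of_ae_trim hle (Integrable.ae_eq_of_forall_setIntegral_eq _ _
    (hint _ (hf.measurable hs)) (hint _ hs) fun B hB _ => ?_)
  rw [← setIntegral_trim hle (measurable_component_real (hf.measurable hs)).stronglyMeasurable hB,
    ← setIntegral_trim hle (measurable_component_real hs).stronglyMeasurable hB,
    setIntegral_component_real (hf.measurable hs) hB, setIntegral_component_real hs hB]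
  have hB' := MeasurableSpace.measurableSet_invariants.1 hB
  conv_lhs => rw [← hB'.2, ← Set.preimage_inter]
  exact hf.measureReal_preimage (hs.inter hB'.1).nullMeasurableSet

/-- Almost every ergodic component is ergodic. -/
theorem ae_ergodic_component (hf : MeasurePreserving f μ μ) :
    ∀ᵐ x ∂μ, Ergodic f (component f μ x) := by
  -- Countability lets a single null set serve all s ∈ S in the three properties that follow.
  obtain ⟨S, hSc, hS, hgen⟩ := exists_countable_isPiSystem X
  have hm : ∀ s ∈ S, MeasurableSet s := fun s hs => by
    rw [hgen]; exact MeasurableSpace.measurableSet_generateFrom hs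
  have h1 : ∀ᵐ x ∂μ, ∀ s ∈ S, (component f μ x).real (f ⁻¹' s) = (component f μ x).real s :=
    (ae_ball_iff hSc).2 fun s hs => ae_component_preimage hf (hm s hs)
  have h2 : ∀ᵐ x ∂μ, ∀ s ∈ S, ∀ᵐ y ∂(component f μ x),
      Tendsto (fun n : ℕ => visits f s n y / n) atTop (𝓝 (visitFrequency f s y)) :=
    (ae_ball_iff hSc).2 fun s hs => ae_ae_component
      ((isSubadditiveCocycle_visits hf.measurable (hm s hs)).kingman zero_le_one hf).1
  have h3 : ∀ᵐ x ∂μ, ∀ s ∈ S, ∀ᵐ y ∂(component f μ x),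
      visitFrequency f s y = visitFrequency f s x :=
    (ae_ball_iff hSc).2 fun s hs => ae_component_eq (measurable_visitFrequency hf.measurable (hm s hs))
  filter_upwards [h1, h2, h3] with x hx1 hx2 hx3
  have hinv : MeasurePreserving f (component f μ x) (component f μ x) := by
    refine ⟨hf.measurable, ?_⟩
    have := Measure.isProbabilityMeasure_map (μ := component f μ x) hf.measurable.aemeasurable
    refine ext_of_generate_finite S hgen hS (fun s hs => ?_) (by simp)
    rw [← measureReal_eq_measureReal_iff, map_measureReal_apply hf.measurable (hm s hs)]
    exact hx1 s hs
  refine ergodic_of_tendsto_visits hinv hS hgen fun s hs => ⟨visitFrequency f s x, ?_⟩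
  filter_upwards [hx2 s hs, hx3 s hs] with y hy1 hy2
  rwa [← hy2]

end ErgodicDecomposition

/-! ### Entropy of the ergodic components. -/

section ComponentEntropy

lemma exists_nat_forall_negMulLog_close {η : ℝ} (hη : 0 < η) :
    ∃ N : ℕ, 0 < N ∧ ∀ s ∈ Set.Icc (0 : ℝ) 1, ∀ t ∈ Set.Icc (0 : ℝ) 1, |s - t| ≤ 1 / N →
      Real.negMulLog s ≤ Real.negMulLog t + η := by
  have h := isCompact_Icc.uniformContinuousOn_of_continuous
    (Real.continuous_negMulLog.continuousOn (s := Set.Icc (0 : ℝ) 1))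
  obtain ⟨δ, hδ, h⟩ := Metric.uniformContinuousOn_iff.1 h η hη
  obtain ⟨N, hN⟩ := exists_nat_one_div_lt hδ
  refine ⟨N + 1, N.succ_pos, fun s hs t ht hst => ?_⟩
  have := h s hs t ht (lt_of_le_of_lt hst (by exact_mod_cast hN))
  rw [Real.dist_eq] at this
  linarith [(abs_lt.1 this).2]

lemma abs_sub_le_of_min_floor_eq {N : ℕ} (hN : 0 < N) {s t : ℝ} (hs : s ∈ Set.Icc (0 : ℝ) 1)
    (ht : t ∈ Set.Icc (0 : ℝ) 1) (h : min ⌊N * s⌋₊ N = min ⌊N * t⌋₊ N) : |s - t| ≤ 1 / N := by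
  have hN' : (0 : ℝ) < N := by exact_mod_cast hN
  have hle : ∀ u ∈ Set.Icc (0 : ℝ) 1, ⌊N * u⌋₊ ≤ N := fun u hu => by
    refine Nat.floor_le_of_le ?_
    nlinarith [hu.2]
  rw [min_eq_left (hle s hs), min_eq_left (hle t ht)] at h
  have h1 := Nat.floor_le (a := N * s) (mul_nonneg hN'.le hs.1)
  have h2 := Nat.lt_floor_add_one (N * s)
  have h3 := Nat.floor_le (a := N * t) (mul_nonneg hN'.le ht.1)
  have h4 := Nat.lt_floor_add_one (N * t)
  rw [h] at h1 h2
  rw [abs_sub_le_iff]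
  constructor <;> rw [le_div_iff₀ hN'] <;> nlinarith

variable {X : Type*} [MeasurableSpace X]

lemma measurePreserving_cond {f : X → X} {μ : Measure X} (hf : MeasurePreserving f μ μ)
    {B : Set X} (hB : MeasurableSet B) (hBf : f ⁻¹' B = B) :
    MeasurePreserving f (ProbabilityTheory.cond μ B) (ProbabilityTheory.cond μ B) := by
  have := hf.restrict_preimage hB
  rw [hBf] at this
  exact this.smul_measure _

/-- For an invariant partition, the entropy per unit time is at most the mean of the entropies of
the conditional measures. -/
lemma mul_le_sum_shannon_cond {f : X → X} {μ : Measure X} [IsProbabilityMeasure μ]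
    (hf : MeasurePreserving f μ μ) {k : ℕ} {P : X → Fin k} (hP : Measurable P) {c : ℝ}
    (hc : ∀ q : ℕ, 0 < q → c * q ≤ shannon μ (itinerary f P q)) {ι : Type*} [Fintype ι]
    [MeasurableSpace ι] [MeasurableSingletonClass ι] {Q : X → ι}
    (hQ : Measurable[MeasurableSpace.invariants f] Q) {n : ℕ} (hn : 0 < n) :
    c * n ≤ ∑ a, μ.real (Q ⁻¹' {a}) *
      shannon (ProbabilityTheory.cond μ (Q ⁻¹' {a})) (itinerary f P n) := by
  have hQm : Measurable Q := hQ.mono (MeasurableSpace.invariants_le f) le_rfl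
  set T := ∑ a, μ.real (Q ⁻¹' {a}) *
      shannon (ProbabilityTheory.cond μ (Q ⁻¹' {a})) (itinerary f P n) with hT
  -- Over blocks of length n * j, naming the cell costs log card once, while subadditivity for the
  -- invariant conditional measures bounds the rest by j * T. A large j makes the fixed cost
  -- negligible.
  have key : ∀ j : ℕ, 0 < j → (j : ℝ) * (c * n) ≤ Real.log (Fintype.card ι) + j * T := by
    intro j hj
    have h1 := hc (n * j) (Nat.mul_pos hn hj)
    have h2 := shannon_le_log_card_add μ hQm (measurable_itinerary hf.measurable hP (n * j))
    have h3 : ∑ a, μ.real (Q ⁻¹' {a}) *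
        shannon (ProbabilityTheory.cond μ (Q ⁻¹' {a})) (itinerary f P (n * j)) ≤ j * T := by
      rw [hT, Finset.mul_sum]
      refine Finset.sum_le_sum fun a _ => ?_
      by_cases h0 : μ (Q ⁻¹' {a}) = 0
      · simp [Measure.real, h0]
      · have := ProbabilityTheory.cond_isProbabilityMeasure h0
        have hB := MeasurableSpace.measurableSet_invariants.1 (hQ (measurableSet_singleton a))
        have h4 := shannon_itinerary_mul_le (measurePreserving_cond hf hB.1 hB.2) hP n j
        calc _ ≤ μ.real (Q ⁻¹' {a}) * (j *
              shannon (ProbabilityTheory.cond μ (Q ⁻¹' {a})) (itinerary f P n)) := by gcongr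
          _ = _ := by ring
    push_cast at h1
    linarith
  by_contra hlt
  push Not at hlt
  obtain ⟨j, hj⟩ := exists_nat_gt (Real.log (Fintype.card ι) / (c * n - T))
  rw [div_lt_iff₀ (by linarith)] at hj
  rcases Nat.eq_zero_or_pos j with rfl | hj0
  · have := Real.log_natCast_nonneg (Fintype.card ι)
    simp at hj
    linarith
  · have := key j hj0
    nlinarith

variable [StandardBorelSpace X] {f : X → X} {μ : Measure X} [IsProbabilityMeasure μ]

lemma measurable_shannon_component {α : Type*} [Fintype α] [MeasurableSpace α]
    [MeasurableSingletonClass α] {g : X → α} (hg : Measurable g) :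
    Measurable fun x => shannon (component f μ x) g :=
  Finset.measurable_sum _ fun a _ => Real.continuous_negMulLog.measurable.comp
    ((measurable_component_real (hg (measurableSet_singleton a))).mono
      (MeasurableSpace.invariants_le f) le_rfl)

lemma integrable_shannon_component {α : Type*} [Fintype α] [MeasurableSpace α]
    [MeasurableSingletonClass α] {g : X → α} (hg : Measurable g) :
    Integrable (fun x => shannon (component f μ x) g) μ := by
  refine .of_bound (measurable_shannon_component hg).aestronglyMeasurable
    (Real.log (Fintype.card α)) (ae_of_all _ fun x => ?_)
  rw [Real.norm_eq_abs, abs_of_nonneg (shannon_nonneg _ _)]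
  exact shannon_le_log_card _ hg

/-- On a cell where the components nearly agree on the fibres of `g`, the entropy of the
conditional measure is bounded by the mean entropy of the components. -/
lemma mul_shannon_cond_le {α : Type*} [Fintype α] [MeasurableSpace α]
    [MeasurableSingletonClass α] {g : X → α} (hg : Measurable g) {η : ℝ} {N : ℕ}
    (hN : ∀ s ∈ Set.Icc (0 : ℝ) 1, ∀ t ∈ Set.Icc (0 : ℝ) 1, |s - t| ≤ 1 / N →
      Real.negMulLog s ≤ Real.negMulLog t + η) {B : Set X}
    (hB : MeasurableSet[MeasurableSpace.invariants f] B)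
    (hBN : ∀ x ∈ B, ∀ y ∈ B, ∀ a,
      |(component f μ x).real (g ⁻¹' {a}) - (component f μ y).real (g ⁻¹' {a})| ≤ 1 / N) :
    μ.real B * shannon (ProbabilityTheory.cond μ B) g ≤
      ∫ x in B, shannon (component f μ x) g ∂μ + μ.real B * (Fintype.card α * η) := by
  have hBm : MeasurableSet B := MeasurableSpace.invariants_le f _ hB
  by_cases h0 : μ.real B = 0
  · simp only [h0, zero_mul, add_zero]
    exact integral_nonneg fun x => shannon_nonneg _ _
  have hpos : 0 < μ.real B := lt_of_le_of_ne measureReal_nonneg (Ne.symm h0)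
  have hga : ∀ a, MeasurableSet (g ⁻¹' {a}) := fun a => hg (measurableSet_singleton a)
  have hprob : IsProbabilityMeasure (ProbabilityTheory.cond μ B) :=
    ProbabilityTheory.cond_isProbabilityMeasure fun h => h0 (by simp [Measure.real, h])
  -- The conditional measure is the average of the components over B, so it is as close to each of
  -- them as they are to one another.
  have hclose : ∀ y ∈ B, ∀ a, |(ProbabilityTheory.cond μ B).real (g ⁻¹' {a}) -
      (component f μ y).real (g ⁻¹' {a})| ≤ 1 / N := by
    intro y hy a
    have hint : Integrable (fun x => (component f μ x).real (g ⁻¹' {a})) (μ.restrict B) :=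
      (ProbabilityTheory.integrable_toReal_condExpKernel (hga a)).integrableOn
    have h1 : μ.real B * (ProbabilityTheory.cond μ B).real (g ⁻¹' {a}) =
        ∫ x in B, (component f μ x).real (g ⁻¹' {a}) ∂μ := by
      rw [setIntegral_component_real (hga a) hB, cond_real_apply μ hBm, mul_inv_cancel_left₀ h0,
        Set.inter_comm]
    have h2 : ∫ x in B, (component f μ x).real (g ⁻¹' {a}) ∂μ ≤
        ∫ x in B, ((component f μ y).real (g ⁻¹' {a}) + 1 / N) ∂μ :=
      setIntegral_mono_on hint (integrable_const _) hBm fun x hx => by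
        linarith [(abs_le.1 (hBN x hx y hy a)).2]
    have h3 : ∫ x in B, ((component f μ y).real (g ⁻¹' {a}) - 1 / N) ∂μ ≤
        ∫ x in B, (component f μ x).real (g ⁻¹' {a}) ∂μ :=
      setIntegral_mono_on (integrable_const _) hint hBm fun x hx => by
        linarith [(abs_le.1 (hBN x hx y hy a)).1]
    rw [← h1, setIntegral_const, smul_eq_mul] at h2 h3
    have h4 := le_of_mul_le_mul_left h2 hpos
    have h5 := le_of_mul_le_mul_left h3 hpos
    rw [abs_le]
    constructor <;> linarith
  have hpt : ∀ y ∈ B, shannon (ProbabilityTheory.cond μ B) g ≤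
      shannon (component f μ y) g + Fintype.card α * η := by
    intro y hy
    calc shannon (ProbabilityTheory.cond μ B) g
        ≤ ∑ a, (Real.negMulLog ((component f μ y).real (g ⁻¹' {a})) + η) :=
          Finset.sum_le_sum fun a _ => hN _ ⟨measureReal_nonneg, measureReal_le_one⟩ _
            ⟨measureReal_nonneg, measureReal_le_one⟩ (hclose y hy a)
      _ = _ := by simp [Finset.sum_add_distrib, shannon]
  have hi := (integrable_shannon_component (f := f) (μ := μ) hg).integrableOn (s := B)
  have h6 : ∫ _ in B, shannon (ProbabilityTheory.cond μ B) g ∂μ ≤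
      ∫ y in B, (shannon (component f μ y) g + Fintype.card α * η) ∂μ :=
    setIntegral_mono_on (integrable_const _) (hi.add (integrable_const _)) hBm hpt
  rw [integral_add hi (integrable_const _), setIntegral_const, setIntegral_const, smul_eq_mul,
    smul_eq_mul] at h6
  exact h6

/-- The entropy per unit time of an invariant measure is at most the mean block entropy of its
ergodic components. -/
lemma mul_le_integral_shannon_component (hf : MeasurePreserving f μ μ) {k : ℕ} {P : X → Fin k}
    (hP : Measurable P) {c : ℝ}
    (hc : ∀ q : ℕ, 0 < q → c * q ≤ shannon μ (itinerary f P q)) {n : ℕ} (hn : 0 < n) :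
    c * n ≤ ∫ x, shannon (component f μ x) (itinerary f P n) ∂μ := by
  have hg := measurable_itinerary hf.measurable hP n
  set g := itinerary f P n
  refine le_of_forall_pos_le_add fun ε hε => ?_
  set M : ℝ := (Fintype.card (Fin n → Fin k) : ℝ)
  obtain ⟨N, hN0, hN⟩ := exists_nat_forall_negMulLog_close (η := ε / (M + 1)) (by positivity)
  -- Rounding the masses given by the component to the grid of step 1/N yields a finite invariant
  -- partition with almost constant block distribution on each cell. The `min` only provides a value
  -- in `Fin (N + 1)`; it is inactive for masses in [0, 1].
  let Q : X → (Fin n → Fin k) → Fin (N + 1) := fun x w =>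
    ⟨min ⌊N * (component f μ x).real (g ⁻¹' {w})⌋₊ N, Nat.lt_succ_of_le (min_le_right _ _)⟩
  have hQ : Measurable[MeasurableSpace.invariants f] Q := by
    refine @measurable_pi_lambda _ _ _ (MeasurableSpace.invariants f) _ _ fun w => ?_
    exact (measurable_of_countable fun m : ℕ =>
      (⟨min m N, Nat.lt_succ_of_le (min_le_right _ _)⟩ : Fin (N + 1))).comp
      (Nat.measurable_floor.comp
        ((measurable_component_real (hg (measurableSet_singleton w))).const_mul (N : ℝ)))
  have hQm : Measurable Q := hQ.mono (MeasurableSpace.invariants_le f) le_rfl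
  have h1 := mul_le_sum_shannon_cond hf hP hc hQ hn
  have h2 : ∀ a, μ.real (Q ⁻¹' {a}) * shannon (ProbabilityTheory.cond μ (Q ⁻¹' {a})) g ≤
      ∫ x in Q ⁻¹' {a}, shannon (component f μ x) g ∂μ +
        μ.real (Q ⁻¹' {a}) * (M * (ε / (M + 1))) := fun a => by
    refine mul_shannon_cond_le hg hN (hQ (measurableSet_singleton a)) fun x hx y hy w => ?_
    refine abs_sub_le_of_min_floor_eq hN0 ⟨measureReal_nonneg, measureReal_le_one⟩
      ⟨measureReal_nonneg, measureReal_le_one⟩ ?_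
    have hxy : Q x = Q y := hx.trans hy.symm
    exact congrArg Fin.val (congrFun hxy w)
  have h3 := h1.trans (Finset.sum_le_sum fun a _ => h2 a)
  rw [Finset.sum_add_distrib, ← Finset.sum_mul, sum_measureReal_fiber_univ μ hQm, one_mul] at h3
  have h4 : ∑ a, ∫ x in Q ⁻¹' {a}, shannon (component f μ x) g ∂μ =
      ∫ x, shannon (component f μ x) g ∂μ := by
    rw [← integral_iUnion_fintype (fun a => hQm (measurableSet_singleton a))]
    · rw [Set.eq_univ_of_forall (s := ⋃ a, Q ⁻¹' {a}) fun x => Set.mem_iUnion.2 ⟨Q x, rfl⟩,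
        Measure.restrict_univ]
    · intro a b hab
      exact Disjoint.preimage _ (by simpa using hab)
    · exact fun a => (integrable_shannon_component hg).integrableOn
  rw [h4] at h3
  have h5 : M * (ε / (M + 1)) ≤ ε := by
    have hM : 0 ≤ M := by positivity
    rw [mul_div_assoc', div_le_iff₀ (by positivity)]
    nlinarith
  linarith

/-- Some ergodic component of an invariant measure has almost the entropy of that measure. -/
theorem exists_ergodic_partitionEntropy_ge (hf : MeasurePreserving f μ μ) {k : ℕ} {P : X → Fin k}
    (hP : Measurable P) {c c' : ℝ}
    (hc : ∀ q : ℕ, 0 < q → c * q ≤ shannon μ (itinerary f P q)) (hc' : c' < c) :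
    ∃ ν ∈ ergodicMeasures f, (c' : EReal) < partitionEntropy f ν P := by
  let u : ℕ → X → ℝ := fun n x => shannon (component f μ x) (itinerary f P n) / n
  have hlog : 0 ≤ Real.log k := Real.log_natCast_nonneg k
  have hu0 : ∀ n x, 0 ≤ u n x := fun n x => div_nonneg (shannon_nonneg _ _) n.cast_nonneg
  have hu1 : ∀ n x, u n x ≤ Real.log k := fun n x => by
    have := shannon_itinerary_le (component f μ x) hf.measurable hP n
    exact div_le_of_le_mul₀ n.cast_nonneg hlog (by linarith)
  have hum : ∀ n, Measurable (u n) := fun n =>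
    (measurable_shannon_component (measurable_itinerary hf.measurable hP n)).div_const _
  let l : X → ℝ := fun x => limsup (fun n => u n x) atTop
  have hergodic := ae_ergodic_component hf
  -- Components are almost surely invariant, so Fekete's lemma gives convergence, and dominated
  -- convergence then carries the bound c to the integral of the limit.
  have hlim : ∀ᵐ x ∂μ, Tendsto (fun n => u n x) atTop (𝓝 (l x)) := by
    filter_upwards [hergodic] with x hx
    have := (subadditive_shannon_itinerary hx.toMeasurePreserving hP).tendsto_lim
      ⟨0, Set.forall_mem_range.2 fun n => hu0 n x⟩
    rw [show l x = _ from this.limsup_eq]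
    exact this
  have hint : Tendsto (fun n => ∫ x, u n x ∂μ) atTop (𝓝 (∫ x, l x ∂μ)) := by
    refine tendsto_integral_of_dominated_convergence (fun _ => Real.log k)
      (fun n => (hum n).aestronglyMeasurable) (integrable_const _)
      (fun n => ae_of_all _ fun x => ?_) hlim
    rw [Real.norm_eq_abs, abs_of_nonneg (hu0 n x)]
    exact hu1 n x
  have hge : c ≤ ∫ x, l x ∂μ := by
    refine ge_of_tendsto hint ?_
    filter_upwards [eventually_gt_atTop 0] with n hn
    have hn0 : (0 : ℝ) < n := by exact_mod_cast hn
    simp only [u]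
    rw [integral_div, le_div_iff₀ hn0]
    exact mul_le_integral_shannon_component hf hP hc hn
  have hex : ∃ᵐ x ∂μ, c' < l x := by
    intro hcon
    have hle : ∫ x, l x ∂μ ≤ ∫ _, c' ∂μ := by
      refine integral_mono_ae ?_ (integrable_const _) (hcon.mono fun x hx => le_of_not_gt hx)
      refine .of_bound (Measurable.limsup hum).aestronglyMeasurable (Real.log k) ?_
      filter_upwards [hlim] with x hx
      rw [Real.norm_eq_abs, abs_of_nonneg (ge_of_tendsto' hx fun n => hu0 n x)]
      exact le_of_tendsto' hx fun n => hu1 n x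
    simp at hle
    linarith
  obtain ⟨x, hx, hxe, hxl⟩ := (hex.and_eventually (hergodic.and hlim)).exists
  refine ⟨⟨component f μ x, inferInstance⟩, hxe, ?_⟩
  have ht : Tendsto (fun n => ((u n x : ℝ) : EReal)) atTop (𝓝 ((l x : ℝ) : EReal)) :=
    (continuous_coe_real_ereal.tendsto _).comp hxl
  have : partitionEntropy f ⟨component f μ x, inferInstance⟩ P = ((l x : ℝ) : EReal) :=
    ht.limsup_eq
  rw [this]
  exact_mod_cast hx

end ComponentEntropy

/-! ### The ergodic lower bound in the variational principle. -/

section VariationalPrinciple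

variable {X : Type*} [MetricSpace X] [CompactSpace X] [MeasurableSpace X] [BorelSpace X]

/-- The lower bound in the variational principle, with ergodic measures. -/
theorem exists_ergodic_metricEntropy_gt [Nonempty X] {f : X → X} (hf : Continuous f) {c : ℝ}
    (hc : (c : EReal) < topEntropy f) :
    ∃ μ ∈ ergodicMeasures f, (c : EReal) < metricEntropy f μ := by
  obtain ⟨d, hcd, hd⟩ := EReal.lt_iff_exists_real_btwn.1 hc
  obtain ⟨ν, hν, k, P, hP, hq⟩ := exists_invariant_shannon_ge hf hd
  obtain ⟨μ, hμ, h⟩ := exists_ergodic_partitionEntropy_ge hν hP hq (by exact_mod_cast hcd)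
  exact ⟨μ, hμ, h.trans_le (le_iSup_of_le k (le_iSup_of_le P (le_iSup_of_le hP le_rfl)))⟩

end VariationalPrinciple

/-! ### The operator norm of matrices. -/

section OpNorm

variable {m : ℕ}

lemma continuous_opNorm : Continuous (opNorm (m := m)) := by
  let T : Matrix (Fin m) (Fin m) ℝ →ₗ[ℝ] (EuclideanSpace ℝ (Fin m) →L[ℝ] EuclideanSpace ℝ (Fin m)) :=
    { toFun := fun M => Matrix.toEuclideanCLM (n := Fin m) (𝕜 := ℝ) M
      map_add' := map_add _
      map_smul' := map_smul _ }
  exact (LinearMap.continuous_of_finiteDimensional T).norm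

lemma opNorm_nonneg (M : Matrix (Fin m) (Fin m) ℝ) : 0 ≤ opNorm M := norm_nonneg _

lemma opNorm_mul_le (M N : Matrix (Fin m) (Fin m) ℝ) : opNorm (M * N) ≤ opNorm M * opNorm N := by
  rw [opNorm, map_mul]
  exact norm_mul_le _ _

lemma opNorm_one_le : opNorm (1 : Matrix (Fin m) (Fin m) ℝ) ≤ 1 := by
  rw [opNorm, map_one]
  exact ContinuousLinearMap.norm_id_le

/-- In dimension 0 even the identity has norm 0. With the convention log 0 = 0 all logarithmic norms
vanish, so this case needs no exclusion. -/
lemma opNorm_of_isEmpty (M : Matrix (Fin 0) (Fin 0) ℝ) : opNorm M = 0 := by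
  rw [opNorm, Subsingleton.elim (Matrix.toEuclideanCLM (n := Fin 0) (𝕜 := ℝ) M) 0, norm_zero]

lemma one_le_opNorm_mul_opNorm_inv [NeZero m] (M : GL (Fin m) ℝ) :
    1 ≤ opNorm (M : Matrix (Fin m) (Fin m) ℝ) *
      opNorm ((M⁻¹ : GL (Fin m) ℝ) : Matrix (Fin m) (Fin m) ℝ) := by
  have h : opNorm (1 : Matrix (Fin m) (Fin m) ℝ) = 1 := by
    have : Nontrivial (EuclideanSpace ℝ (Fin m)) := inferInstance
    rw [opNorm, map_one]
    exact norm_one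
  rw [← h]
  refine le_trans (le_of_eq ?_) (opNorm_mul_le _ _)
  rw [← Units.val_mul, mul_inv_cancel, Units.val_one]

lemma opNorm_pos [NeZero m] (M : GL (Fin m) ℝ) : 0 < opNorm (M : Matrix (Fin m) (Fin m) ℝ) := by
  refine lt_of_le_of_ne (opNorm_nonneg _) fun h => ?_
  have := one_le_opNorm_mul_opNorm_inv M
  rw [← h, zero_mul] at this
  linarith

end OpNorm

/-! ### The maximal Lyapunov exponent as a subadditive limit. -/

section LogNormCocycle

variable {X : Type*} {m : ℕ}

/-- The sequence `log ‖A(x, n)‖`. -/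
noncomputable def logNorm (f : X → X) (A : X → GL (Fin m) ℝ) (n : ℕ) (x : X) : ℝ :=
  Real.log (opNorm (cocycle f A x n : Matrix (Fin m) (Fin m) ℝ))

lemma cocycle_add (f : X → X) (A : X → GL (Fin m) ℝ) (x : X) (n p : ℕ) :
    cocycle f A x (n + p) = cocycle f A (f^[n] x) p * cocycle f A x n := by
  induction p with
  | zero => simp [cocycle]
  | succ p ih =>
    rw [← add_assoc, cocycle, ih, cocycle, ← Function.iterate_add_apply, add_comm p n, mul_assoc]

lemma opNorm_cocycle_le {f : X → X} {A : X → GL (Fin m) ℝ} {K : ℝ} (hK : 0 ≤ K)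
    (hA : ∀ x, opNorm (A x : Matrix (Fin m) (Fin m) ℝ) ≤ K) (x : X) (n : ℕ) :
    opNorm (cocycle f A x n : Matrix (Fin m) (Fin m) ℝ) ≤ K ^ n := by
  induction n with
  | zero => simpa [cocycle] using opNorm_one_le
  | succ n ih =>
    rw [cocycle, Units.val_mul, pow_succ']
    exact (opNorm_mul_le _ _).trans (mul_le_mul (hA _) ih (opNorm_nonneg _) hK)

lemma opNorm_cocycle_inv_le {f : X → X} {A : X → GL (Fin m) ℝ} {K : ℝ} (hK : 0 ≤ K)
    (hA : ∀ x, opNorm ((A x)⁻¹ : GL (Fin m) ℝ).1 ≤ K) (x : X) (n : ℕ) :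
    opNorm ((cocycle f A x n)⁻¹ : GL (Fin m) ℝ).1 ≤ K ^ n := by
  induction n with
  | zero => simpa [cocycle] using opNorm_one_le
  | succ n ih =>
    rw [cocycle, mul_inv_rev, Units.val_mul, pow_succ]
    exact (opNorm_mul_le _ _).trans (mul_le_mul ih (hA _) (opNorm_nonneg _) (by positivity))

/-- The lower bound comes from the inverse cocycle, because the norms of a matrix and of its inverse
have product at least 1. -/
lemma abs_logNorm_le {f : X → X} {A : X → GL (Fin m) ℝ} {K : ℝ} (hK : 1 ≤ K)
    (hA : ∀ x, opNorm (A x).1 ≤ K) (hA' : ∀ x, opNorm ((A x)⁻¹ : GL (Fin m) ℝ).1 ≤ K)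
    (n : ℕ) (x : X) : |logNorm f A n x| ≤ Real.log K * n := by
  have hlog := Real.log_nonneg hK
  rcases Nat.eq_zero_or_pos m with rfl | hm
  · simp only [logNorm, opNorm_of_isEmpty, Real.log_zero, abs_zero]
    positivity
  have : NeZero m := ⟨hm.ne'⟩
  have h1 := opNorm_cocycle_le (f := f) (by linarith) hA x n
  have h2 := opNorm_cocycle_inv_le (f := f) (by linarith) hA' x n
  have h3 := one_le_opNorm_mul_opNorm_inv (cocycle f A x n)
  have h4 := opNorm_pos (cocycle f A x n)
  have h5 := opNorm_pos (cocycle f A x n)⁻¹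
  have h6 := Real.log_le_log h4 h1
  have h7 := Real.log_le_log h5 h2
  have h8 := Real.log_le_log one_pos h3
  rw [Real.log_mul h4.ne' h5.ne', Real.log_one] at h8
  rw [Real.log_pow] at h6 h7
  simp only [logNorm]
  rw [abs_le]
  constructor <;> linarith

lemma logNorm_add_le (f : X → X) (A : X → GL (Fin m) ℝ) (n p : ℕ) (x : X) :
    logNorm f A (n + p) x ≤ logNorm f A n x + logNorm f A p (f^[n] x) := by
  rcases Nat.eq_zero_or_pos m with rfl | hm
  · simp [logNorm, opNorm_of_isEmpty]
  have : NeZero m := ⟨hm.ne'⟩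
  simp only [logNorm]
  rw [add_comm (Real.log _), ← Real.log_mul (opNorm_pos _).ne' (opNorm_pos _).ne']
  refine Real.log_le_log (opNorm_pos _) ?_
  rw [cocycle_add, Units.val_mul]
  exact opNorm_mul_le _ _

lemma continuous_logNorm [TopologicalSpace X] {f : X → X} (hf : Continuous f)
    {A : X → GL (Fin m) ℝ} (hA : Continuous A) (n : ℕ) : Continuous (logNorm f A n) := by
  rcases Nat.eq_zero_or_pos m with rfl | hm
  · have : logNorm f A n = fun _ => 0 := funext fun x => by simp [logNorm, opNorm_of_isEmpty]
    exact this ▸ continuous_const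
  have : NeZero m := ⟨hm.ne'⟩
  have hc : Continuous fun x => cocycle f A x n := by
    induction n with
    | zero => exact continuous_const
    | succ n ih => exact (hA.comp (hf.iterate n)).mul ih
  exact (continuous_opNorm.comp (Units.continuous_val.comp hc)).log fun x => (opNorm_pos _).ne'

variable [TopologicalSpace X] [CompactSpace X] [MeasurableSpace X] [OpensMeasurableSpace X]

lemma exists_isSubadditiveCocycle_logNorm {f : X → X} (hf : Continuous f)
    {A : X → GL (Fin m) ℝ} (hA : Continuous A) :
    ∃ C : ℝ, 0 ≤ C ∧ IsSubadditiveCocycle f (logNorm f A) C := by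
  have h1 : Continuous fun x => opNorm (A x).1 :=
    continuous_opNorm.comp (Units.continuous_val.comp hA)
  have h2 : Continuous fun x => opNorm ((A x)⁻¹ : GL (Fin m) ℝ).1 :=
    continuous_opNorm.comp (Units.continuous_val.comp hA.inv)
  obtain ⟨K₁, hK₁⟩ := (isCompact_range h1).bddAbove
  obtain ⟨K₂, hK₂⟩ := (isCompact_range h2).bddAbove
  have hK : 1 ≤ max 1 (max K₁ K₂) := le_max_left _ _
  exact ⟨_, Real.log_nonneg hK, fun n => (continuous_logNorm hf hA n).measurable,
    abs_logNorm_le hK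
      (fun x => (hK₁ ⟨x, rfl⟩).trans ((le_max_left _ _).trans (le_max_right _ _)))
      (fun x => (hK₂ ⟨x, rfl⟩).trans ((le_max_right _ _).trans (le_max_right _ _))),
    logNorm_add_le f A⟩

/-- `limUnder` has an arbitrary value where the limit fails to exist. The limsup agrees with it
almost everywhere by Kingman's theorem and is measurable and bounded everywhere, independently of
the measure. -/
lemma mle_eq_integral_limsup {f : X → X} (hf : Continuous f) {A : X → GL (Fin m) ℝ}
    (hA : Continuous A) {μ : ProbabilityMeasure X} (hμ : μ ∈ invariantMeasures f) :
    mle f A μ = ∫ x, limsup (fun n : ℕ => logNorm f A n x / n) atTop ∂(μ : Measure X) := by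
  obtain ⟨C, hC, h⟩ := exists_isSubadditiveCocycle_logNorm hf hA
  refine integral_congr_ae ?_
  filter_upwards [(h.kingman hC hμ).1] with x hx
  refine Tendsto.limUnder_eq (hx.congr fun n => ?_)
  rw [one_div, inv_mul_eq_div, logNorm]

lemma mle_eq_iInf {f : X → X} (hf : Continuous f) {A : X → GL (Fin m) ℝ} (hA : Continuous A)
    {μ : ProbabilityMeasure X} (hμ : μ ∈ invariantMeasures f) :
    mle f A μ = ⨅ n : ℕ, (∫ x, logNorm f A (n + 1) x ∂(μ : Measure X)) / (n + 1 : ℕ) := by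
  obtain ⟨C, hC, h⟩ := exists_isSubadditiveCocycle_logNorm hf hA
  rw [mle_eq_integral_limsup hf hA hμ, (h.kingman hC hμ).2]

lemma mle_le_div {f : X → X} (hf : Continuous f) {A : X → GL (Fin m) ℝ} (hA : Continuous A)
    {μ : ProbabilityMeasure X} (hμ : μ ∈ invariantMeasures f) (n : ℕ) :
    mle f A μ ≤ (∫ x, logNorm f A (n + 1) x ∂(μ : Measure X)) / (n + 1 : ℕ) := by
  obtain ⟨C, hC, h⟩ := exists_isSubadditiveCocycle_logNorm hf hA
  rw [mle_eq_integral_limsup hf hA hμ]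
  exact h.integral_limsup_le hC hμ n.succ_pos

/-- Upper semicontinuity of the maximal Lyapunov exponent on the invariant measures. -/
lemma eventually_mle_lt {f : X → X} (hf : Continuous f) {A : X → GL (Fin m) ℝ}
    (hA : Continuous A) {μ : ProbabilityMeasure X} (hμ : μ ∈ invariantMeasures f) {a : ℝ}
    (ha : mle f A μ < a) : ∀ᶠ ν in 𝓝 μ, ν ∈ invariantMeasures f → mle f A ν < a := by
  rw [mle_eq_iInf hf hA hμ] at ha
  -- A single time n already witnesses the inequality, and the integral of its continuous function
  -- varies continuously with the measure.
  obtain ⟨n, hn⟩ := exists_lt_of_ciInf_lt ha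
  have hc := ProbabilityMeasure.tendsto_iff_forall_integral_tendsto.1
    (tendsto_id (α := ProbabilityMeasure X) (x := 𝓝 μ))
    (BoundedContinuousFunction.mkOfCompact ⟨_, continuous_logNorm hf hA (n + 1)⟩)
  filter_upwards [(hc.div_const ((n + 1 : ℕ) : ℝ)).eventually_lt_const hn] with ν hν hinv
  exact (mle_le_div hf hA hinv n).trans_lt hν

end LogNormCocycle

/-! ### Entropy and exponent of convex combinations. -/

section Mixture

variable {X : Type*} [MeasurableSpace X]

/-- The convex combination `t μ + (1 - t) ν`. -/
noncomputable def mix (t : unitInterval) (μ ν : ProbabilityMeasure X) : ProbabilityMeasure X :=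
  ⟨ENNReal.ofReal t • (μ : Measure X) + ENNReal.ofReal (1 - t) • (ν : Measure X), by
    constructor
    simp only [Measure.add_apply, Measure.smul_apply, measure_univ, smul_eq_mul, mul_one]
    rw [← ENNReal.ofReal_add t.2.1 (by linarith [t.2.2])]
    simp⟩

lemma coe_mix (t : unitInterval) (μ ν : ProbabilityMeasure X) :
    (mix t μ ν : Measure X) =
      ENNReal.ofReal t • (μ : Measure X) + ENNReal.ofReal (1 - t) • (ν : Measure X) := rfl

lemma mix_real (t : unitInterval) (μ ν : ProbabilityMeasure X) (s : Set X) :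
    (mix t μ ν : Measure X).real s =
      t * (μ : Measure X).real s + (1 - t) * (ν : Measure X).real s := by
  have ht : (0 : ℝ) ≤ 1 - t := by linarith [t.2.2]
  simp only [Measure.real, coe_mix, Measure.add_apply, Measure.smul_apply, smul_eq_mul]
  rw [ENNReal.toReal_add (ENNReal.mul_ne_top ENNReal.ofReal_ne_top (measure_ne_top _ _))
    (ENNReal.mul_ne_top ENNReal.ofReal_ne_top (measure_ne_top _ _)), ENNReal.toReal_mul,
    ENNReal.toReal_mul, ENNReal.toReal_ofReal t.2.1, ENNReal.toReal_ofReal ht]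

lemma mix_mem_invariantMeasures {f : X → X} (t : unitInterval) {μ ν : ProbabilityMeasure X}
    (hμ : μ ∈ invariantMeasures f) (hν : ν ∈ invariantMeasures f) :
    mix t μ ν ∈ invariantMeasures f := by
  refine ⟨hμ.measurable, ?_⟩
  rw [coe_mix, Measure.map_add _ _ hμ.measurable, Measure.map_smul, Measure.map_smul, hμ.map_eq,
    hν.map_eq]

lemma mul_shannon_le_shannon_mix {α : Type*} [Fintype α] (t : unitInterval)
    (μ ν : ProbabilityMeasure X) (g : X → α) :
    t * shannon (μ : Measure X) g ≤ shannon (mix t μ ν : Measure X) g := by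
  have ht : (0 : ℝ) ≤ 1 - t := by linarith [t.2.2]
  have h := sum_mul_shannon_le (Finset.univ : Finset Bool)
    (fun b => if b then (t : ℝ) else 1 - t) (fun b _ => by cases b <;> simp [ht, t.2.1])
    (by simp) (fun b => if b then (μ : Measure X) else (ν : Measure X)) (mix t μ ν : Measure X) g
    (fun a => by rw [mix_real, Fintype.sum_bool]; rfl)
  simp only [Fintype.sum_bool, if_true, Bool.false_eq_true, if_false] at h
  have := mul_nonneg ht (shannon_nonneg (ν : Measure X) g)
  linarith

/-- By concavity of block entropy the mixture retains t times the entropy of μ for one good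
partition. The weight t depends on μ and c alone, so the same t serves different partners ν. -/
lemma exists_forall_lt_metricEntropy_mix {f : X → X} {μ : ProbabilityMeasure X} {c : ℝ}
    (hc : (c : EReal) < metricEntropy f μ) :
    ∃ t : unitInterval, (t : ℝ) < 1 ∧
      ∀ ν : ProbabilityMeasure X, (c : EReal) < metricEntropy f (mix t μ ν) := by
  simp only [metricEntropy, lt_iSup_iff] at hc
  obtain ⟨k, P, hP, hlt⟩ := hc
  obtain ⟨d, hcd, hd⟩ := EReal.lt_iff_exists_real_btwn.1 hlt
  have hcd' : c < d := by exact_mod_cast hcd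
  have hev : ∀ᶠ t in 𝓝[<] (1 : ℝ), c < t * d := by
    have : Tendsto (fun t : ℝ => t * d) (𝓝[<] 1) (𝓝 (1 * d)) :=
      (tendsto_id.mul_const d).mono_left nhdsWithin_le_nhds
    exact this.eventually_const_lt (by simpa using hcd')
  have hev2 : ∀ᶠ t in 𝓝[<] (1 : ℝ), t ∈ Set.Ioo (0 : ℝ) 1 := Ioo_mem_nhdsLT one_pos
  obtain ⟨t, htd, ht0, ht1⟩ := (hev.and hev2).exists
  refine ⟨⟨t, ht0.le, ht1.le⟩, ht1, fun ν => ?_⟩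
  have hle : ((t * d : ℝ) : EReal) ≤ partitionEntropy f (mix ⟨t, ht0.le, ht1.le⟩ μ ν) P := by
    refine le_limsup_of_frequently_le ?_
    refine (frequently_lt_of_lt_limsup (by isBoundedDefault) hd).mono fun n hn => ?_
    have hn' : d < joinEntropy f μ P n / n := by exact_mod_cast hn
    rw [EReal.coe_le_coe_iff]
    have h := mul_shannon_le_shannon_mix ⟨t, ht0.le, ht1.le⟩ μ ν (itinerary f P n)
    simp only at h
    calc t * d ≤ t * (joinEntropy f μ P n / n) := by gcongr
      _ = t * joinEntropy f μ P n / n := by ring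
      _ ≤ _ := by
        rw [joinEntropy_eq_shannon, joinEntropy_eq_shannon]
        gcongr
  refine lt_of_lt_of_le (by exact_mod_cast htd) (hle.trans ?_)
  exact le_iSup_of_le k (le_iSup_of_le P (le_iSup_of_le hP le_rfl))

/-- The same limsup function represents the exponent of every invariant measure, so the exponent is
affine by linearity of the integral in the measure. -/
lemma mle_mix [TopologicalSpace X] [CompactSpace X] [OpensMeasurableSpace X] {m : ℕ} {f : X → X}
    (hf : Continuous f) {A : X → GL (Fin m) ℝ} (hA : Continuous A) (t : unitInterval)
    {μ ν : ProbabilityMeasure X} (hμ : μ ∈ invariantMeasures f) (hν : ν ∈ invariantMeasures f) :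
    mle f A (mix t μ ν) = t * mle f A μ + (1 - t) * mle f A ν := by
  obtain ⟨C, hC, h⟩ := exists_isSubadditiveCocycle_logNorm hf hA
  have ht : (0 : ℝ) ≤ 1 - t := by linarith [t.2.2]
  rw [mle_eq_integral_limsup hf hA (mix_mem_invariantMeasures t hμ hν),
    mle_eq_integral_limsup hf hA hμ, mle_eq_integral_limsup hf hA hν, coe_mix,
    integral_add_measure ((h.integrable_limsup hC _).smul_measure ENNReal.ofReal_ne_top)
      ((h.integrable_limsup hC _).smul_measure ENNReal.ofReal_ne_top),
    integral_smul_measure, integral_smul_measure, ENNReal.toReal_ofReal t.2.1,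
    ENNReal.toReal_ofReal ht, smul_eq_mul, smul_eq_mul]

end Mixture

lemma ergodicMeasures_subset_invariantMeasures {X : Type*} [MeasurableSpace X] (f : X → X) :
    ergodicMeasures f ⊆ invariantMeasures f := fun _ h => h.toMeasurePreserving

/-! ### The suprema over pairs of ergodic measures. -/

section Main

variable {X : Type*} [MetricSpace X] [CompactSpace X] [MeasurableSpace X] [BorelSpace X] {m : ℕ}

lemma topEntropy_eq_iSup_max {f : X → X} (hf : Continuous f) (A : X → GL (Fin m) ℝ)
    (hne : ∃ μ ∈ ergodicMeasures f, ∃ ν ∈ ergodicMeasures f, mle f A μ ≠ mle f A ν) :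
    topEntropy f = ⨆ (μ ∈ ergodicMeasures f) (ν ∈ ergodicMeasures f)
      (_ : mle f A ν < mle f A μ), max (metricEntropy f μ) (metricEntropy f ν) := by
  obtain ⟨μ₁, hμ₁, μ₂, hμ₂, hne⟩ := hne
  have : Nonempty X := μ₁.nonempty
  refine le_antisymm (EReal.ge_of_forall_gt_iff_ge.1 fun c hc => ?_) ?_
  · obtain ⟨μ, hμ, hcμ⟩ := exists_ergodic_metricEntropy_gt hf hc
    -- The exponent of μ cannot equal both of the two distinct given exponents.
    obtain ⟨ν, hν, hμν⟩ : ∃ ν ∈ ergodicMeasures f, mle f A ν ≠ mle f A μ := by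
      by_cases h : mle f A μ₁ = mle f A μ
      · exact ⟨μ₂, hμ₂, fun h' => hne (h.trans h'.symm)⟩
      · exact ⟨μ₁, hμ₁, h⟩
    refine hcμ.le.trans ?_
    rcases hμν.lt_or_gt with h | h
    · exact le_iSup₂_of_le μ hμ (le_iSup₂_of_le ν hν (le_iSup_of_le h (le_max_left _ _)))
    · exact le_iSup₂_of_le ν hν (le_iSup₂_of_le μ hμ (le_iSup_of_le h (le_max_right _ _)))
  · exact iSup₂_le fun μ hμ => iSup₂_le fun ν hν => iSup_le fun _ => max_le
      (metricEntropy_le_topEntropy hf (ergodicMeasures_subset_invariantMeasures f hμ))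
      (metricEntropy_le_topEntropy hf (ergodicMeasures_subset_invariantMeasures f hν))

lemma supNonMinimizing_eq_iSup_min {f : X → X} (hf : Continuous f) {A : X → GL (Fin m) ℝ}
    (hA : Continuous A) (hd : EntropyDense f) :
    supNonMinimizing f A = ⨆ (μ ∈ ergodicMeasures f) (ν ∈ ergodicMeasures f)
      (_ : mle f A ν < mle f A μ), min (metricEntropy f μ) (metricEntropy f ν) := by
  have hsub := ergodicMeasures_subset_invariantMeasures f
  refine le_antisymm ?_ ?_
  · refine iSup₂_le fun μ hμ => iSup_le fun hlt => EReal.ge_of_forall_gt_iff_ge.1 fun c hc => ?_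
    simp only [iInf_lt_iff] at hlt
    obtain ⟨ν, hν, hνμ⟩ := hlt
    have hνμ' : mle f A ν < mle f A μ := by exact_mod_cast hνμ
    -- The measure ν is merely invariant and may have zero entropy; mixing in a little of it lowers
    -- the exponent below that of μ at small cost in entropy.
    obtain ⟨t, ht1, ht⟩ := exists_forall_lt_metricEntropy_mix hc
    have hinv := mix_mem_invariantMeasures t (hsub hμ) hν
    have hmix : mle f A (mix t μ ν) < mle f A μ := by
      rw [mle_mix hf hA t (hsub hμ) hν]
      nlinarith
    -- The neighbourhood lives in all probability measures, so invariance appears as a premise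
    -- inside it; ergodicity of ρ discharges it.
    obtain ⟨ρ, hρ, hρG, hcρ⟩ := hd _ hinv _ (eventually_mle_lt hf hA hinv hmix) c (ht ν)
    exact le_iSup₂_of_le μ hμ (le_iSup₂_of_le ρ hρ (le_iSup_of_le (hρG (hsub hρ))
      (le_min hc.le hcρ.le)))
  · refine iSup₂_le fun μ hμ => iSup₂_le fun ν hν => iSup_le fun h => ?_
    refine (min_le_left _ _).trans (le_iSup₂_of_le μ hμ (le_iSup_of_le ?_ le_rfl))
    exact (iInf₂_le ν (hsub hν)).trans_lt (by exact_mod_cast h)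

lemma iSup_min_eq_topEntropy {f : X → X} (hf : Continuous f) {A : X → GL (Fin m) ℝ}
    (hA : Continuous A)
    (hne : ∃ μ ∈ ergodicMeasures f, ∃ ν ∈ ergodicMeasures f, mle f A μ ≠ mle f A ν)
    (hd : EntropyDense f)
    (hl : LowerSemicontinuousOn (fun μ => mle f A μ) (invariantMeasures f)) :
    (⨆ (μ ∈ ergodicMeasures f) (ν ∈ ergodicMeasures f)
      (_ : mle f A ν < mle f A μ), min (metricEntropy f μ) (metricEntropy f ν)) =
      topEntropy f := by
  have hsub := ergodicMeasures_subset_invariantMeasures f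
  refine le_antisymm ?_ (EReal.ge_of_forall_gt_iff_ge.1 fun c hc => ?_)
  · exact iSup₂_le fun μ hμ => iSup₂_le fun ν hν => iSup_le fun _ =>
      (min_le_left _ _).trans (metricEntropy_le_topEntropy hf (hsub hμ))
  obtain ⟨μ₁, hμ₁, μ₂, hμ₂, hlt⟩ : ∃ μ ∈ ergodicMeasures f, ∃ ν ∈ ergodicMeasures f,
      mle f A μ < mle f A ν := by
    obtain ⟨μ, hμ, ν, hν, h⟩ := hne
    rcases h.lt_or_gt with h | h
    · exact ⟨μ, hμ, ν, hν, h⟩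
    · exact ⟨ν, hν, μ, hμ, h⟩
  have : Nonempty X := μ₁.nonempty
  obtain ⟨μ, hμ, hcμ⟩ := exists_ergodic_metricEntropy_gt hf hc
  obtain ⟨t, ht1, ht⟩ := exists_forall_lt_metricEntropy_mix hcμ
  have hinv₁ := mix_mem_invariantMeasures t (hsub hμ) (hsub hμ₁)
  have hinv₂ := mix_mem_invariantMeasures t (hsub hμ) (hsub hμ₂)
  -- The part coming from μ is common to both mixtures, and 1 - t > 0 preserves the strict
  -- inequality.
  have hmix : mle f A (mix t μ μ₁) < mle f A (mix t μ μ₂) := by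
    rw [mle_mix hf hA t (hsub hμ) (hsub hμ₁), mle_mix hf hA t (hsub hμ) (hsub hμ₂)]
    nlinarith
  obtain ⟨a, ha₁, ha₂⟩ := exists_between hmix
  obtain ⟨ρ₁, hρ₁, hG₁, hcρ₁⟩ := hd _ hinv₁ _ (eventually_mle_lt hf hA hinv₁ ha₁) c (ht μ₁)
  -- Lower semicontinuity keeps the exponents near the second mixture above a; upper semicontinuity
  -- has kept those near the first below a.
  have hev := eventually_nhdsWithin_iff.1 (hl _ hinv₂ a ha₂)
  obtain ⟨ρ₂, hρ₂, hG₂, hcρ₂⟩ := hd _ hinv₂ _ hev c (ht μ₂)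
  have h₁ : mle f A ρ₁ < a := hG₁ (hsub hρ₁)
  have h₂ : a < mle f A ρ₂ := hG₂ (hsub hρ₂)
  exact le_iSup₂_of_le ρ₂ hρ₂ (le_iSup₂_of_le ρ₁ hρ₁ (le_iSup_of_le (h₁.trans h₂)
    (le_min hcρ₂.le hcρ₁.le)))

end Main

end LyapCocycle

theorem proposition2p12 {X : Type*} [MetricSpace X] [CompactSpace X] [MeasurableSpace X]
    [BorelSpace X] {m : ℕ} (f : X ≃ₜ X) (A : X → GL (Fin m) ℝ) (hA : Continuous A)
    (hne : ∃ μ ∈ LyapCocycle.ergodicMeasures f, ∃ ν ∈ LyapCocycle.ergodicMeasures f,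
      LyapCocycle.mle f A μ ≠ LyapCocycle.mle f A ν) :
    LyapCocycle.topEntropy f =
      (⨆ (μ ∈ LyapCocycle.ergodicMeasures f) (ν ∈ LyapCocycle.ergodicMeasures f)
        (_ : LyapCocycle.mle f A ν < LyapCocycle.mle f A μ),
        max (LyapCocycle.metricEntropy f μ) (LyapCocycle.metricEntropy f ν)) ∧
    (LyapCocycle.EntropyDense f →
      LyapCocycle.supNonMinimizing f A =
        (⨆ (μ ∈ LyapCocycle.ergodicMeasures f) (ν ∈ LyapCocycle.ergodicMeasures f)
          (_ : LyapCocycle.mle f A ν < LyapCocycle.mle f A μ),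
          min (LyapCocycle.metricEntropy f μ) (LyapCocycle.metricEntropy f ν)) ∧
      (LowerSemicontinuousOn (fun μ => LyapCocycle.mle f A μ)
          (LyapCocycle.invariantMeasures f) →
        LyapCocycle.supNonMinimizing f A = LyapCocycle.topEntropy f ∧
        (⨆ (μ ∈ LyapCocycle.ergodicMeasures f) (ν ∈ LyapCocycle.ergodicMeasures f)
          (_ : LyapCocycle.mle f A ν < LyapCocycle.mle f A μ),
          min (LyapCocycle.metricEntropy f μ) (LyapCocycle.metricEntropy f ν)) =
          LyapCocycle.topEntropy f)) := by
  have hf := f.continuous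
  refine ⟨LyapCocycle.topEntropy_eq_iSup_max hf A hne, fun hd => ?_⟩
  have hmin := LyapCocycle.supNonMinimizing_eq_iSup_min hf hA hd
  refine ⟨hmin, fun hl => ?_⟩
  have htop := LyapCocycle.iSup_min_eq_topEntropy hf hA hne hd hl
  exact ⟨hmin.trans htop, htop⟩
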